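/- Let $\Phi_1$ (hole centers) and $\Phi_2$ (baseline process) be independent homogeneous Poisson point processes in $\mathbb{R}^2$ with densities $\lambda_1>0$ and $\lambda_2>0$. Let $D>0$ and write $\mathbf b(y,D)=\{z\in\mathbb R^2:\|z-y\|<D\}$. Put $\Xi_D=\bigcup_{y\in\Phi_1}\mathbf b(y,D)$ and let $\Psi=\Phi_2\setminus\Xi_D$ be the Poisson hole process (PHP). Let $P>0$ be the transmit power and $\alpha>2$ the path-loss exponent. Attach to the points $x$ of $\Phi_2$ i.i.d. fading gains $h_x\sim\exp(1)$, independent of $(\Phi_1,\Phi_2)$. The interference at a typical node, located at the origin $\mathbf o$, is $$I=\sum_{x\in\Psi}P\,h_x\,\|x\|^{-\alpha}.$$ The typical node lies outside all holes, that is, $\Phi_1$ is conditioned to have no point in $\mathbf b(\mathbf o,D)$; accordingly put $\mathcal L_I(s)=\mathbb E\left[e^{-sI}\mid \Phi_1\cap\mathbf b(\mathbf o,D)=\emptyset\right]$. Then (given this event) $I<\infty$ almost surely, and for every $s>0$ $$\mathcal L_I(s)\le \exp\left(-\pi\lambda_2\frac{(sP)^{2/\alpha}}{\mathrm{sinc}(2/\alpha)}\right)\,\exp\left(-2\pi\lambda_1\int_D^\infty\left(1-e^{f(v)}\right)v\,\mathrm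 dv\right),$$ where $\mathrm{sinc}(x)=\frac{\sin(\pi x)}{\pi x}$, $$f(v)=\int_{v-D}^{v+D}\arccos\left(\frac{r^2+v^2-D^2}{2vr}\right)\frac{2\lambda_2}{1+\frac{r^\alpha}{Ps}}\,r\,\mathrm dr,$$ and the integral over $[D,\infty)$ converges absolutely. -/

import Mathlib

open MeasureTheory ProbabilityTheory

noncomputable section

/-- The Euclidean plane, with the Euclidean norm and Lebesgue measure. -/
abbrev Plane : Type := EuclideanSpace ℝ (Fin 2)

/-- The number of points of the point process `{X 0, X 1, …}` that lie in `B`. -/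
def pointCount {Ω : Type*} (X : ℕ → Ω → Plane) (B : Set Plane) (ω : Ω) : ℕ∞ :=
  {n : ℕ | X n ω ∈ B}.encard

/-- `X` is a (measurable) enumeration of the points of a homogeneous Poisson point process
of density `lam` in the plane: the number of points in a bounded Borel set `B` is Poisson
distributed with mean `lam * |B|`, and the numbers of points in finitely many pairwise disjoint
bounded Borel sets are independent.  (For `lam > 0` such a process has almost surely infinitely
many points, all distinct, so that its points can be enumerated by `ℕ`.) -/
structure IsPoissonPointProcess {Ω : Type*} [MeasurableSpace Ω] (μ : Measure Ω)
    (X : ℕ → Ω → Plane) (lam : ℝ) : Prop where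
  measurable : ∀ n, Measurable (X n)
  count_law : ∀ B : Set Plane, MeasurableSet B → Bornology.IsBounded B → ∀ k : ℕ,
    μ {ω | pointCount X B ω = k} = poissonMeasure (lam.toNNReal * (volume B).toNNReal) {k}
  count_indep : ∀ (m : ℕ) (B : Fin m → Set Plane), (∀ i, MeasurableSet (B i)) →
    (∀ i, Bornology.IsBounded (B i)) → Pairwise (fun i j => Disjoint (B i) (B j)) →
    iIndepFun (fun i => pointCount X (B i)) μ

/-- `h` is a sequence of independent exponential random variables with mean one. -/
structure IsRayleighFading {Ω : Type*} [MeasurableSpace Ω] (μ : Measure Ω)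
    (h : ℕ → Ω → ℝ) : Prop where
  measurable : ∀ n, Measurable (h n)
  law : ∀ n, μ.map (h n) = expMeasure 1
  indep : iIndepFun h μ

/-- The region covered by the holes: the union of the open disks of radius `D` around the
points of `Y`. -/
def holeRegion {Ω : Type*} (Y : ℕ → Ω → Plane) (D : ℝ) (ω : Ω) : Set Plane :=
  ⋃ n, Metric.ball (Y n ω) D

/-- The power received at the origin from the point `X n` of the baseline process: it is
`P * h n * ‖X n‖ ^ (-α)` if `X n` lies outside the holes, i.e. is a point of the Poisson hole
process, and zero otherwise; `h n` is the fading gain of the link from `X n`. -/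
def receivedPower {Ω : Type*} (X Y : ℕ → Ω → Plane) (h : ℕ → Ω → ℝ) (P α D : ℝ) (ω : Ω)
    (n : ℕ) : ℝ :=
  (holeRegion Y D ω)ᶜ.indicator (fun x => P * h n ω * ‖x‖ ^ (-α)) (X n ω)

/-- The interference power at the origin from all points of the Poisson hole process. -/
def interference {Ω : Type*} (X Y : ℕ → Ω → Plane) (h : ℕ → Ω → ℝ) (P α D : ℝ) (ω : Ω) : ℝ :=
  ∑' n, receivedPower X Y h P α D ω n

/-- The event that the origin lies outside the holes: no hole centre is at distance less than
`D` from the origin. -/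
def originOutsideHoles {Ω : Type*} (Y : ℕ → Ω → Plane) (D : ℝ) : Set Ω :=
  {ω | (0 : Plane) ∉ holeRegion Y D ω}

/-- The normalized cardinal sine `sin (π x) / (π x)`. -/
def normalizedSinc (x : ℝ) : ℝ := Real.sinc (Real.pi * x)

/-- The exponent that a single hole with centre at distance `v` from the origin contributes. -/
def holeExponent (lam₂ P α D s v : ℝ) : ℝ :=
  ∫ r in (v - D)..(v + D),
    Real.arccos ((r ^ 2 + v ^ 2 - D ^ 2) / (2 * v * r)) * (2 * lam₂ / (1 + r ^ α / (P * s))) * r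

end

/-!
# Laplace transform of the interference in a Poisson hole process

Fix `s` and let `κ r = 1 / (1 + r ^ α / (P * s))` be `lossDensity (P * s) α r`. An exponential gain
`h` satisfies `E exp (-a * h) = 1 / (1 + a)`, so averaging `exp (-s * I)` over the fading turns each
point `x` of the baseline process outside the holes into the factor `1 - κ ‖x‖`
(`fadingFactor`, `setLIntegral_exp_interference_le_prod`). For fixed hole centres, the Laplace
functional of the baseline process bounds the mean of the product of these factors by
`exp (-lam₂ ∫ κ ‖x‖)`, the integral being over the complement of the holes
(`IsPoissonPointProcess.lintegral_iInf_prod_le`, `setLIntegral_exp_interference_le`). That integral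
is the one over the whole plane minus the one over the union of the holes, and the latter is at most
the sum over the single holes: this neglect of overlaps is where the inequality in the theorem
comes from (`ofReal_exp_setIntegral_iUnion_ball_le`). What remains is
`E ∏ exp (lam₂ ∫ κ over the disk around Y n)` on the event that no hole centre is within `D` of the
origin, which is again a multiplicative functional of a Poisson process, for a function that
vanishes on the disk around the origin (`IsPoissonPointProcess.setLIntegral_iSup_prod_le`,
`setLIntegral_iSup_prod_exp_holeMass_le`).

Both functionals only have to be bounded from above. For a simple function that is `1` off a bounded
set they reduce to generating functions of independent Poisson counts
(`IsPoissonPointProcess.exists_prod_simpleFunc`); monotonicity and Fatou's lemma give the general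
bounds.

The explicit form comes from polar coordinates: `∫ κ` over the plane is a Gamma integral evaluated
by the reflection formula (`integral_lossDensity_norm`), and the integral of `lam₂ κ` over a disk is
`holeExponent`, by the law of cosines (`holeExponent_norm`). Almost sure convergence of the
interference follows from Campbell's formula (`ae_summable_receivedPower`), and absolute convergence
of the integral over `[D, ∞)` from the integrability of the mass of a disk as a function of its
centre (`integrable_setIntegral_ball`).
-/

open Filter Topology
open scoped ENNReal NNReal

/-! ### Poisson counts -/

lemma lintegral_pow_poissonMeasure (m c : ℝ≥0) :
    ∫⁻ n, (c : ℝ≥0∞) ^ n ∂(poissonMeasure m) = ENNReal.ofReal (Real.exp (m * (c - 1))) := by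
  rw [lintegral_countable']
  have h1 : ∀ n : ℕ, (c : ℝ≥0∞) ^ n * poissonMeasure m {n} =
      ENNReal.ofReal (Real.exp (-m) * ((m * c : ℝ) ^ n / (n.factorial))) := by
    intro n
    rw [poissonMeasure_singleton, ← ENNReal.ofReal_coe_nnreal, ← ENNReal.ofReal_pow c.coe_nonneg,
      ← ENNReal.ofReal_mul (by positivity)]
    congr 1
    rw [mul_pow]; ring
  simp_rw [h1]
  have h2 : HasSum (fun n : ℕ => Real.exp (-m) * ((m * c : ℝ) ^ n / (n.factorial)))
      (Real.exp (-m) * Real.exp (m * c)) := by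
    have := NormedSpace.expSeries_div_hasSum_exp (m * c : ℝ)
    rw [← Real.exp_eq_exp_ℝ] at this
    exact this.mul_left _
  rw [← ENNReal.ofReal_tsum_of_nonneg (fun n => by positivity) h2.summable, h2.tsum_eq,
    ← Real.exp_add]
  congr 2; ring

namespace IsPoissonPointProcess

variable {Ω : Type*} [MeasurableSpace Ω] {μ : Measure Ω} {X : ℕ → Ω → Plane} {lam : ℝ}

lemma measurable_pointCount (hX : IsPoissonPointProcess μ X lam) {B : Set Plane}
    (hB : MeasurableSet B) : Measurable (pointCount X B) := by
  refine measurable_encard.comp (measurable_set_iff.2 fun n => ?_)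
  exact (hX.measurable n hB).mem

lemma map_pointCount [IsProbabilityMeasure μ] (hX : IsPoissonPointProcess μ X lam) {B : Set Plane}
    (hB : MeasurableSet B) (hb : Bornology.IsBounded B) :
    μ.map (pointCount X B) =
      (poissonMeasure (lam.toNNReal * (volume B).toNNReal)).map (Nat.cast : ℕ → ℕ∞) := by
  have hN := hX.measurable_pointCount hB
  have : IsProbabilityMeasure (μ.map (pointCount X B)) :=
    Measure.isProbabilityMeasure_map hN.aemeasurable
  have hfin : ∀ k : ℕ, μ.map (pointCount X B) {(k : ℕ∞)} =
      (poissonMeasure (lam.toNNReal * (volume B).toNNReal)).map (Nat.cast : ℕ → ℕ∞) {(k : ℕ∞)} := by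
    intro k
    rw [Measure.map_apply hN (measurableSet_singleton _),
      Measure.map_apply .of_discrete (measurableSet_singleton _)]
    have h1 : (Nat.cast : ℕ → ℕ∞) ⁻¹' {(k : ℕ∞)} = {k} := by ext; simp
    rw [h1, ← hX.count_law B hB hb k]
    rfl
  -- two probability measures on `ℕ∞` that agree on the finite values agree at `⊤` too
  have htop : ∀ ν : Measure ℕ∞, IsProbabilityMeasure ν → ν {⊤} = 1 - ∑' k : ℕ, ν {(k : ℕ∞)} := by
    intro ν hν
    have h1 : ({⊤} : Set ℕ∞) = (⋃ k : ℕ, {(k : ℕ∞)})ᶜ := by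
      ext n
      induction n using ENat.recTopCoe <;> simp
    rw [h1, prob_compl_eq_one_sub .of_discrete, measure_iUnion _ fun _ => .of_discrete]
    intro i j hij
    simpa [Function.onFun, eq_comm] using hij
  refine Measure.ext_of_singleton fun n => ?_
  induction n using ENat.recTopCoe with
  | top =>
    rw [htop _ inferInstance, htop _ inferInstance]
    simp_rw [hfin]
  | coe k => exact hfin k

lemma ae_pointCount_ne_top [IsProbabilityMeasure μ] (hX : IsPoissonPointProcess μ X lam)
    {B : Set Plane} (hB : MeasurableSet B) (hb : Bornology.IsBounded B) :
    ∀ᵐ ω ∂μ, pointCount X B ω ≠ ⊤ := by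
  refine ae_of_ae_map (p := fun n : ℕ∞ => n ≠ ⊤) (hX.measurable_pointCount hB).aemeasurable ?_
  rw [hX.map_pointCount hB hb, ae_map_iff .of_discrete .of_discrete]
  simp

lemma lintegral_pow_pointCount [IsProbabilityMeasure μ] (hX : IsPoissonPointProcess μ X lam)
    (hlam : 0 ≤ lam) {B : Set Plane} (hB : MeasurableSet B) (hb : Bornology.IsBounded B)
    (c : ℝ≥0) :
    ∫⁻ ω, (c : ℝ≥0∞) ^ (pointCount X B ω).toNat ∂μ =
      ENNReal.ofReal (Real.exp (lam * volume.real B * (c - 1))) := by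
  have h1 := lintegral_map (μ := μ) (f := fun n : ℕ∞ => (c : ℝ≥0∞) ^ n.toNat) .of_discrete
    (hX.measurable_pointCount hB)
  rw [← h1, hX.map_pointCount hB hb, lintegral_map .of_discrete .of_discrete]
  simp only [ENat.toNat_natCast]
  rw [lintegral_pow_poissonMeasure]
  simp [Measure.real, Real.coe_toNNReal _ hlam, ENNReal.coe_toNNReal_eq_toReal]

lemma lintegral_pointCount [IsProbabilityMeasure μ] (hX : IsPoissonPointProcess μ X lam)
    {B : Set Plane} (hB : MeasurableSet B) (hb : Bornology.IsBounded B) :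
    ∫⁻ ω, (pointCount X B ω : ℝ≥0∞) ∂μ = ENNReal.ofReal lam * volume B := by
  have h1 := lintegral_map (μ := μ) (f := fun n : ℕ∞ => (n : ℝ≥0∞)) .of_discrete
    (hX.measurable_pointCount hB)
  rw [← h1, hX.map_pointCount hB hb, lintegral_map .of_discrete .of_discrete]
  simp only [ENat.toENNReal_coe]
  set m := lam.toNNReal * (volume B).toNNReal with hm
  have hm' : (m : ℝ≥0∞) = ENNReal.ofReal lam * volume B := by
    rw [hm, ENNReal.coe_mul, ENNReal.coe_toNNReal hb.measure_lt_top.ne]; rfl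
  rw [← hm', lintegral_countable', tsum_eq_zero_add' ENNReal.summable]
  simp only [Nat.cast_zero, zero_mul, zero_add]
  have h2 : ∀ n : ℕ, ((n + 1 : ℕ) : ℝ≥0∞) * poissonMeasure m {n + 1} =
      m * poissonMeasure m {n} := by
    intro n
    rw [poissonMeasure_singleton, poissonMeasure_singleton, ← ENNReal.ofReal_natCast,
      ← ENNReal.ofReal_coe_nnreal, ← ENNReal.ofReal_mul (by positivity),
      ← ENNReal.ofReal_mul (by positivity)]
    congr 1
    rw [Nat.factorial_succ]
    push_cast
    field_simp
    ring
  simp_rw [h2]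
  rw [ENNReal.tsum_mul_left]
  have h3 := lintegral_countable' (μ := poissonMeasure m) (fun _ => 1)
  simp only [lintegral_one, measure_univ, one_mul] at h3
  rw [← h3, mul_one]

/-- The multiplicative functional of a Poisson point process for a simple function that differs
from `1` only on a bounded set: only finitely many factors differ from `1`, and they are grouped by
their value. -/
lemma exists_prod_simpleFunc [IsProbabilityMeasure μ] (hX : IsPoissonPointProcess μ X lam)
    (hlam : 0 ≤ lam) (f : SimpleFunc Plane ℝ≥0) {R : ℝ} (hf : ∀ x, f x ≠ 1 → ‖x‖ < R) :
    ∃ Z : Ω → ℝ≥0, (∀ᵐ ω ∂μ, ∀ᶠ N in atTop, ∏ n ∈ Finset.range N, f (X n ω) = Z ω) ∧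
      ∫⁻ ω, Z ω ∂μ = ENNReal.ofReal (Real.exp (lam * ∫ x, ((f x : ℝ) - 1))) := by
  classical
  set S : Finset ℝ≥0 := f.range.erase 1 with hS
  have hmeas : ∀ c, MeasurableSet (f ⁻¹' {c}) := fun c => f.measurableSet_preimage _
  have hbdd : ∀ c ∈ S, Bornology.IsBounded (f ⁻¹' {c}) := by
    intro c hc
    refine Bornology.IsBounded.subset (Metric.isBounded_ball (x := (0 : Plane)) (r := R))
      fun x hx => ?_
    rw [mem_ball_zero_iff]
    refine hf x ?_
    rw [show f x = c from hx]
    exact (Finset.mem_erase.1 hc).1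
  refine ⟨fun ω => ∏ c ∈ S, c ^ (pointCount X (f ⁻¹' {c}) ω).toNat, ?_, ?_⟩
  · have hfin : ∀ᵐ ω ∂μ, ∀ c ∈ S, pointCount X (f ⁻¹' {c}) ω ≠ ⊤ := by
      rw [Filter.eventually_all_finset]
      exact fun c hc => hX.ae_pointCount_ne_top (hmeas c) (hbdd c hc)
    filter_upwards [hfin] with ω hω
    have hev : ∀ᶠ N in atTop, ∀ c ∈ S,
        (pointCount X (f ⁻¹' {c}) ω).toNat =
          ((Finset.range N).filter fun n => f (X n ω) = c).card := by
      rw [Filter.eventually_all_finset]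
      intro c hc
      have hf1 : {n : ℕ | X n ω ∈ f ⁻¹' {c}}.Finite := Set.encard_ne_top_iff.1 (hω c hc)
      obtain ⟨M, hM⟩ := hf1.bddAbove
      filter_upwards [eventually_gt_atTop M] with N hN
      have : {n : ℕ | X n ω ∈ f ⁻¹' {c}} =
          ((Finset.range N).filter (fun n => f (X n ω) = c) : Finset ℕ) := by
        ext n
        simp only [Set.mem_preimage, Set.mem_singleton_iff, Set.mem_ofPred_eq, Finset.coe_filter,
          Finset.mem_range]
        exact ⟨fun h => ⟨(hM h).trans_lt hN, h⟩, fun h => h.2⟩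
      rw [pointCount, this, Set.encard_coe_eq_coe_finsetCard, ENat.toNat_natCast]
    filter_upwards [hev] with N hN
    have h1 := Finset.prod_fiberwise_of_maps_to (s := Finset.range N) (t := f.range)
      (g := fun n => f (X n ω)) (fun n _ => f.mem_range_self _) (fun n => f (X n ω))
    rw [← h1, ← Finset.prod_erase (s := f.range) (a := 1)]
    · refine Finset.prod_congr rfl fun c hc => ?_
      rw [hN c hc, Finset.prod_congr rfl (g := fun _ => c), Finset.prod_const]
      intro n hn
      exact (Finset.mem_filter.1 hn).2
    · exact Finset.prod_eq_one fun n hn => (Finset.mem_filter.1 hn).2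
  · let e := S.equivFin
    have hdisj : Pairwise (fun i j => Disjoint (f ⁻¹' {((e.symm i : S) : ℝ≥0)})
        (f ⁻¹' {((e.symm j : S) : ℝ≥0)})) := by
      intro i j hij
      refine Disjoint.preimage _ ?_
      rw [Set.disjoint_singleton]
      intro h
      exact hij (e.symm.injective (Subtype.ext h))
    have hind := hX.count_indep S.card (fun i => f ⁻¹' {((e.symm i : S) : ℝ≥0)})
      (fun i => hmeas _) (fun i => hbdd _ (e.symm i).2) hdisj
    have h1 : ∀ ω, ((∏ c ∈ S, c ^ (pointCount X (f ⁻¹' {c}) ω).toNat : ℝ≥0) : ℝ≥0∞) =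
        ∏ i : Fin S.card, (((e.symm i : S) : ℝ≥0) : ℝ≥0∞) ^
          (pointCount X (f ⁻¹' {((e.symm i : S) : ℝ≥0)}) ω).toNat := by
      intro ω
      rw [ENNReal.ofNNReal_finsetProd, ← Finset.prod_coe_sort, ← e.symm.prod_comp]
      simp
    simp_rw [h1]
    rw [lintegral_prod_eq_prod_lintegral_of_indepFun Finset.univ
      (fun i ω => (((e.symm i : S) : ℝ≥0) : ℝ≥0∞) ^
          (pointCount X (f ⁻¹' {((e.symm i : S) : ℝ≥0)}) ω).toNat)
      (hind.comp (fun i n => (((e.symm i : S) : ℝ≥0) : ℝ≥0∞) ^ n.toNat) fun _ => .of_discrete)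
      (fun i => (Measurable.of_discrete (f := fun n : ℕ∞ =>
        (((e.symm i : S) : ℝ≥0) : ℝ≥0∞) ^ n.toNat)).comp (hX.measurable_pointCount (hmeas _)))]
    have h2 : ∀ i : Fin S.card, ∫⁻ ω, (((e.symm i : S) : ℝ≥0) : ℝ≥0∞) ^
          (pointCount X (f ⁻¹' {((e.symm i : S) : ℝ≥0)}) ω).toNat ∂μ = ENNReal.ofReal
        (Real.exp (lam * volume.real (f ⁻¹' {((e.symm i : S) : ℝ≥0)}) *
          (((e.symm i : S) : ℝ≥0) - 1))) := fun i =>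
      hX.lintegral_pow_pointCount hlam (hmeas _) (hbdd _ (e.symm i).2) _
    simp_rw [h2]
    rw [← ENNReal.ofReal_prod_of_nonneg (fun _ _ => (Real.exp_pos _).le), ← Real.exp_sum]
    congr 2
    have h3 := e.symm.sum_comp (fun c : S => lam * volume.real (f ⁻¹' {(c : ℝ≥0)}) *
          (((c : ℝ≥0) : ℝ) - 1))
    rw [h3, Finset.sum_coe_sort S (fun c : ℝ≥0 => lam * volume.real (f ⁻¹' {c}) * ((c : ℝ) - 1))]
    have h4 : ∀ x, ((f x : ℝ) - 1) =
        ∑ c ∈ S, (f ⁻¹' {c}).indicator (fun _ => (c : ℝ) - 1) x := by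
      intro x
      by_cases hx : f x = 1
      · rw [Finset.sum_eq_zero]
        · simp [hx]
        · intro c hc
          rw [Set.indicator_of_notMem]
          intro h
          exact (Finset.mem_erase.1 hc).1 ((show f x = c from h).symm.trans hx)
      · rw [Finset.sum_eq_single (f x)]
        · simp
        · intro c _ hc
          rw [Set.indicator_of_notMem]
          exact fun h => hc (show f x = c from h).symm
        · intro h
          exact absurd (Finset.mem_erase.2 ⟨hx, f.mem_range_self x⟩) h
    simp_rw [h4]
    rw [integral_finsetSum, Finset.mul_sum]
    · refine Finset.sum_congr rfl fun c hc => ?_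
      rw [integral_indicator_const _ (hmeas c), smul_eq_mul, mul_assoc]
    · intro c hc
      exact (integrable_indicator_iff (hmeas c)).2
        (integrableOn_const (hbdd c hc).measure_lt_top.ne)

end IsPoissonPointProcess

/-! ### Campbell's formula and multiplicative functionals -/

/-- A measurable nonnegative function is the limit of simple functions below it that have bounded
support. -/
lemma exists_tendsto_simpleFunc_le {φ : Plane → ℝ≥0} (hφ : Measurable φ) :
    ∃ f : ℕ → SimpleFunc Plane ℝ≥0, (∀ k x, f k x ≤ φ x) ∧ (∀ k x, f k x ≠ 0 → ‖x‖ < k) ∧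
      ∀ x, Tendsto (fun k => f k x) atTop (𝓝 (φ x)) := by
  have hm : Measurable (fun x => (φ x : ℝ≥0∞)) := hφ.coe_nnreal_ennreal
  let e : ℕ → SimpleFunc Plane ℝ≥0 :=
    fun k => (SimpleFunc.eapprox (fun x => (φ x : ℝ≥0∞)) k).map ENNReal.toNNReal
  have hle : ∀ k x, e k x ≤ φ x := by
    intro k x
    have h1 : SimpleFunc.eapprox (fun x => (φ x : ℝ≥0∞)) k x ≤ φ x := by
      rw [← SimpleFunc.iSup_eapprox_apply hm x]
      exact le_iSup (fun n => (SimpleFunc.eapprox (fun x => (φ x : ℝ≥0∞)) n) x) k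
    exact ENNReal.toNNReal_mono ENNReal.coe_ne_top h1
  refine ⟨fun k => (e k).restrict (Metric.ball 0 k), fun k x => ?_, fun k x hx => ?_, fun x => ?_⟩
  · rw [SimpleFunc.restrict_apply _ measurableSet_ball]
    exact (Set.indicator_le_self _ _ x).trans (hle k x)
  · rw [SimpleFunc.restrict_apply _ measurableSet_ball] at hx
    simpa using Set.mem_of_indicator_ne_zero hx
  · have h1 : Tendsto (fun k => e k x) atTop (𝓝 (φ x)) :=
      (ENNReal.tendsto_toNNReal ENNReal.coe_ne_top).comp (SimpleFunc.tendsto_eapprox hm x)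
    refine h1.congr' ?_
    obtain ⟨K, hK⟩ := exists_nat_gt ‖x‖
    filter_upwards [eventually_ge_atTop K] with k hk
    rw [SimpleFunc.restrict_apply _ measurableSet_ball, Set.indicator_of_mem]
    rw [mem_ball_zero_iff]
    exact hK.trans_le (by exact_mod_cast hk)

namespace IsPoissonPointProcess

variable {Ω : Type*} [MeasurableSpace Ω] {μ : Measure Ω} {X : ℕ → Ω → Plane} {lam : ℝ}

/-- Campbell's formula. -/
lemma tsum_lintegral [IsProbabilityMeasure μ] (hX : IsPoissonPointProcess μ X lam)
    {φ : Plane → ℝ≥0∞} (hφ : Measurable φ) :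
    ∑' n, ∫⁻ ω, φ (X n ω) ∂μ = ENNReal.ofReal lam * ∫⁻ x, φ x := by
  have hbdd : ∀ B : Set Plane, MeasurableSet B → Bornology.IsBounded B →
      Measure.sum (fun n => μ.map (X n)) B = ENNReal.ofReal lam * volume B := by
    intro B hB hb
    rw [← hX.lintegral_pointCount hB hb, Measure.sum_apply _ hB]
    have h1 : ∀ ω, (pointCount X B ω : ℝ≥0∞) = ∑' n, (X n ⁻¹' B).indicator 1 ω := by
      intro ω
      rw [pointCount, ← ENNReal.tsum_set_one, tsum_subtype {n | X n ω ∈ B} (fun _ => (1 : ℝ≥0∞))]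
      rfl
    simp_rw [h1]
    rw [lintegral_tsum fun n =>
      (measurable_one.indicator (hX.measurable n hB)).aemeasurable]
    congr 1
    ext n
    rw [lintegral_indicator_one (hX.measurable n hB), Measure.map_apply (hX.measurable n) hB]
  have hsum : Measure.sum (fun n => μ.map (X n)) = ENNReal.ofReal lam • volume := by
    refine (Measure.ext_iff_of_iUnion_eq_univ (s := fun k : ℕ => Metric.ball (0 : Plane) k)
      (Metric.iUnion_ball_nat 0)).2 fun k => ?_
    ext B hB
    rw [Measure.restrict_apply hB, Measure.restrict_apply hB, Measure.smul_apply, smul_eq_mul]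
    exact hbdd _ (hB.inter measurableSet_ball) (Metric.isBounded_ball.subset Set.inter_subset_right)
  rw [← smul_eq_mul, ← lintegral_smul_measure, ← hsum, lintegral_sum_measure]
  congr 1
  ext n
  rw [lintegral_map hφ (hX.measurable n)]

/-- Upper bound for the Laplace functional: `E ∏ u(X n) ≤ exp (-lam ∫ (1 - u))` for `u ≤ 1`. -/
lemma lintegral_iInf_prod_le [IsProbabilityMeasure μ] (hX : IsPoissonPointProcess μ X lam)
    (hlam : 0 ≤ lam) {u : Plane → ℝ≥0} (hu : Measurable u) (hu1 : ∀ x, u x ≤ 1)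
    (hi : Integrable fun x => 1 - (u x : ℝ)) :
    ∫⁻ ω, ⨅ N, ((∏ n ∈ Finset.range N, u (X n ω) : ℝ≥0) : ℝ≥0∞) ∂μ ≤
      ENNReal.ofReal (Real.exp (-(lam * ∫ x, (1 - (u x : ℝ))))) := by
  obtain ⟨f, hfle, hfb, hft⟩ := exists_tendsto_simpleFunc_le (φ := fun x => 1 - u x)
    (measurable_const.sub hu)
  have hcoe : ∀ x, ((1 - u x : ℝ≥0) : ℝ) = 1 - u x := fun x => NNReal.coe_sub (hu1 x)
  have hfle1 : ∀ k x, f k x ≤ 1 := fun k x => (hfle k x).trans tsub_le_self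
  have hint : Tendsto (fun k => ∫ x, (f k x : ℝ)) atTop (𝓝 (∫ x, (1 - (u x : ℝ)))) := by
    refine tendsto_integral_of_dominated_convergence (fun x => 1 - (u x : ℝ))
      (fun k => (f k).measurable.coe_nnreal_real.aestronglyMeasurable) hi
      (fun k => Eventually.of_forall fun x => ?_) (Eventually.of_forall fun x => ?_)
    · rw [Real.norm_of_nonneg (f k x).coe_nonneg, ← hcoe x]
      exact_mod_cast hfle k x
    · rw [← hcoe x]
      exact NNReal.tendsto_coe.2 (hft x)
  refine ge_of_tendsto' (ENNReal.tendsto_ofReal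
    ((Real.continuous_exp.tendsto _).comp ((hint.const_mul lam).neg))) fun k => ?_
  obtain ⟨Z, hZ, hZi⟩ := hX.exists_prod_simpleFunc hlam ((f k).map (fun c => 1 - c)) (R := k) (by
    intro x hx
    refine hfb k x fun h => hx ?_
    simp [h])
  have h1 : ∀ x, (((f k).map (fun c => 1 - c) x : ℝ≥0) : ℝ) - 1 = -(f k x : ℝ) := by
    intro x
    rw [SimpleFunc.map_apply, NNReal.coe_sub (hfle1 k x)]
    simp
  simp_rw [h1] at hZi
  rw [integral_neg, mul_neg] at hZi
  rw [Function.comp_apply, ← hZi]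
  refine lintegral_mono_ae ?_
  filter_upwards [hZ] with ω hω
  obtain ⟨N, hN⟩ := hω.exists
  refine iInf_le_of_le N ?_
  rw [← hN]
  refine ENNReal.coe_le_coe.2 (Finset.prod_le_prod' fun n _ => ?_)
  rw [SimpleFunc.map_apply]
  exact (le_tsub_iff_right (hfle1 k _)).2 ((le_tsub_iff_left (hu1 _)).1 (hfle k _))

/-- Upper bound for the exponential moments on the event that `B` contains no point, for a function
that vanishes on `B` and is at least `1` elsewhere. -/
lemma setLIntegral_iSup_prod_le [IsProbabilityMeasure μ] (hX : IsPoissonPointProcess μ X lam)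
    (hlam : 0 ≤ lam) {B : Set Plane} (hB : MeasurableSet B) (hb : Bornology.IsBounded B)
    {v : Plane → ℝ≥0} (hv : Measurable v) (hv0 : ∀ x ∈ B, v x = 0) (hv1 : ∀ x ∉ B, 1 ≤ v x)
    (hi : Integrable fun x => (v x : ℝ) - 1) :
    ∫⁻ ω in {ω | ∀ n, X n ω ∉ B}, ⨆ N, ((∏ n ∈ Finset.range N, v (X n ω) : ℝ≥0) : ℝ≥0∞) ∂μ ≤
      ENNReal.ofReal (Real.exp (lam * ∫ x, ((v x : ℝ) - 1))) := by
  have hA : MeasurableSet {ω | ∀ n, X n ω ∉ B} := by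
    have : {ω | ∀ n, X n ω ∉ B} = ⋂ n, X n ⁻¹' Bᶜ := by ext; simp
    rw [this]
    exact MeasurableSet.iInter fun n => hX.measurable n hB.compl
  have hmono : ∀ w : Plane → ℝ≥0, (∀ x ∉ B, 1 ≤ w x) → ∀ ω ∈ {ω | ∀ n, X n ω ∉ B},
      Monotone fun N => ((∏ n ∈ Finset.range N, w (X n ω) : ℝ≥0) : ℝ≥0∞) := by
    intro w hw ω hω
    refine monotone_nat_of_le_succ fun N => ENNReal.coe_le_coe.2 ?_
    rw [Finset.prod_range_succ]
    exact le_mul_of_one_le_right' (hw _ (hω N))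
  obtain ⟨R, hR⟩ : ∃ R : ℝ, ∀ x ∈ B, ‖x‖ < R := by
    obtain ⟨R, hR⟩ := hb.subset_ball 0
    exact ⟨R, fun x hx => by simpa using hR hx⟩
  obtain ⟨f, hfle, hfb, hft⟩ := exists_tendsto_simpleFunc_le (φ := fun x => v x - 1)
    (hv.sub measurable_const)
  -- the approximation of `v`: it vanishes on `B` as `v` does, and equals `1 + f k` elsewhere
  let g : ℕ → SimpleFunc Plane ℝ≥0 := fun k =>
    SimpleFunc.piecewise B hB (SimpleFunc.const _ 0) ((f k).map (fun c => 1 + c))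
  have hgB : ∀ k, ∀ x ∈ B, g k x = 0 := fun k x hx => by simp [g, hx]
  have hgBc : ∀ k, ∀ x ∉ B, g k x = 1 + f k x := fun k x hx => by simp [g, hx]
  have hgt : ∀ x, Tendsto (fun k => g k x) atTop (𝓝 (v x)) := by
    intro x
    by_cases hx : x ∈ B
    · simp_rw [hgB _ x hx, hv0 x hx]; exact tendsto_const_nhds
    · simp_rw [hgBc _ x hx]
      have := (hft x).const_add 1
      rwa [add_tsub_cancel_of_le (hv1 x hx)] at this
  have hint : Tendsto (fun k => ∫ x, ((g k x : ℝ) - 1)) atTop (𝓝 (∫ x, ((v x : ℝ) - 1))) := by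
    refine tendsto_integral_of_dominated_convergence (fun x => |(v x : ℝ) - 1|)
      (fun k => ((g k).measurable.coe_nnreal_real.sub_const 1).aestronglyMeasurable) hi.abs
      (fun k => Eventually.of_forall fun x => ?_) (Eventually.of_forall fun x => ?_)
    · by_cases hx : x ∈ B
      · simp [hgB k x hx, hv0 x hx]
      · have h1 : (f k x : ℝ) ≤ ((v x - 1 : ℝ≥0) : ℝ) := by exact_mod_cast hfle k x
        rw [NNReal.coe_sub (hv1 x hx)] at h1
        rw [hgBc k x hx, NNReal.coe_add, NNReal.coe_one, add_sub_cancel_left,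
          Real.norm_of_nonneg (f k x).coe_nonneg]
        exact h1.trans (le_abs_self _)
    · exact (NNReal.tendsto_coe.2 (hgt x)).sub_const 1
  have hmeas : ∀ w : Plane → ℝ≥0, Measurable w → ∀ N : ℕ,
      Measurable fun ω => ((∏ n ∈ Finset.range N, w (X n ω) : ℝ≥0) : ℝ≥0∞) := fun w hw N =>
    (Finset.measurable_prod _ fun n _ => hw.comp (hX.measurable n)).coe_nnreal_ennreal
  rw [lintegral_iSup' (fun N => (hmeas v hv N).aemeasurable)
    ((ae_restrict_mem hA).mono (hmono v hv1))]
  refine iSup_le fun N => ?_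
  have hlim : Tendsto (fun k => ENNReal.ofReal (Real.exp (lam * ∫ x, ((g k x : ℝ) - 1)))) atTop
      (𝓝 (ENNReal.ofReal (Real.exp (lam * ∫ x, ((v x : ℝ) - 1))))) :=
    ENNReal.tendsto_ofReal ((Real.continuous_exp.tendsto _).comp (hint.const_mul lam))
  calc ∫⁻ ω in {ω | ∀ n, X n ω ∉ B}, ((∏ n ∈ Finset.range N, v (X n ω) : ℝ≥0) : ℝ≥0∞) ∂μ
      = ∫⁻ ω in {ω | ∀ n, X n ω ∉ B},
          liminf (fun k => ((∏ n ∈ Finset.range N, g k (X n ω) : ℝ≥0) : ℝ≥0∞)) atTop ∂μ := by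
        refine lintegral_congr fun ω => ?_
        refine (Tendsto.liminf_eq ?_).symm
        exact ENNReal.tendsto_coe.2 (tendsto_finsetProd _ fun n _ => hgt _)
    _ ≤ liminf (fun k => ∫⁻ ω in {ω | ∀ n, X n ω ∉ B},
          ((∏ n ∈ Finset.range N, g k (X n ω) : ℝ≥0) : ℝ≥0∞) ∂μ) atTop :=
        lintegral_liminf_le fun k => hmeas _ (g k).measurable N
    _ ≤ liminf (fun k => ENNReal.ofReal (Real.exp (lam * ∫ x, ((g k x : ℝ) - 1)))) atTop := by
        refine liminf_le_liminf (Eventually.of_forall fun k => ?_)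
        obtain ⟨Z, hZ, hZi⟩ := hX.exists_prod_simpleFunc hlam (g k) (R := max R k) (by
          intro x hx
          by_cases hxB : x ∈ B
          · exact (hR x hxB).trans_le (le_max_left _ _)
          · refine (hfb k x fun h => hx ?_).trans_le (le_max_right _ _)
            simp [hgBc k x hxB, h])
        change _ ≤ ENNReal.ofReal (Real.exp (lam * ∫ x, ((g k x : ℝ) - 1)))
        rw [← hZi]
        refine le_trans ?_ (setLIntegral_le_lintegral {ω | ∀ n, X n ω ∉ B} _)
        refine lintegral_mono_ae ?_
        filter_upwards [ae_restrict_mem hA, ae_restrict_of_ae hZ] with ω hωA hω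
        obtain ⟨M, hNM, hM⟩ := ((eventually_ge_atTop N).and hω).exists
        rw [← hM]
        exact hmono (g k) (fun x hx => by rw [hgBc k x hx]; exact le_self_add) ω hωA hNM
    _ = _ := hlim.liminf_eq

end IsPoissonPointProcess

/-! ### Polar coordinates and the loss density -/

lemma lintegral_ofReal_eq_of_integral_eq {E : Type*} [MeasurableSpace E] {ν : Measure E}
    {f : E → ℝ} {a : ℝ} (hf : 0 ≤ᵐ[ν] f) (ha : 0 < a) (h : ∫ x, f x ∂ν = a) :
    ∫⁻ x, ENNReal.ofReal (f x) ∂ν = ENNReal.ofReal a := by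
  have hi : Integrable f ν := by
    by_contra hn
    rw [integral_undef hn] at h
    exact ha.ne h
  rw [← h, ofReal_integral_eq_lintegral_ofReal hi hf]

/-- There is an isometry of the plane with `ℂ` under which a given point becomes a nonnegative real
number. -/
lemma exists_linearIsometryEquiv_complex (y : Plane) : ∃ T : ℂ ≃ₗᵢ[ℝ] Plane, T (‖y‖ : ℂ) = y := by
  let T₀ := Complex.orthonormalBasisOneI.repr
  refine ⟨T₀.trans (Submodule.reflection (Submodule.span ℝ {T₀ (‖y‖ : ℂ) - y})ᗮ), ?_⟩
  rw [LinearIsometryEquiv.trans_apply]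
  refine Submodule.reflection_sub ?_
  rw [LinearIsometryEquiv.norm_map]
  simp

lemma lintegral_plane_eq_polar (T : ℂ ≃ₗᵢ[ℝ] Plane) {F : Plane → ℝ≥0∞} (hF : Measurable F) :
    ∫⁻ x, F x = ∫⁻ r in Set.Ioi (0 : ℝ), ENNReal.ofReal r * ∫⁻ θ in Set.Ioo (-Real.pi) Real.pi,
      F (T (r * (Real.cos θ + Real.sin θ * Complex.I))) := by
  have hT : Measurable T := T.continuous.measurable
  have hm : Measurable fun p : ℝ × ℝ =>
      F (T (p.1 * (Real.cos p.2 + Real.sin p.2 * Complex.I))) := by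
    refine hF.comp (hT.comp ?_)
    fun_prop
  rw [← T.measurePreserving.lintegral_comp hF, ← Complex.lintegral_comp_polarCoord_symm,
    polarCoord_target, Measure.volume_eq_prod, ← Measure.prod_restrict]
  simp only [Complex.polarCoord_symm_apply, smul_eq_mul]
  rw [lintegral_prod _ (Measurable.aemeasurable (by fun_prop))]
  refine lintegral_congr fun r => ?_
  rw [← lintegral_const_mul]
  exact hm.comp (measurable_const.prodMk measurable_id)

lemma norm_polar (T : ℂ ≃ₗᵢ[ℝ] Plane) {r : ℝ} (hr : 0 ≤ r) (θ : ℝ) :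
    ‖T (r * (Real.cos θ + Real.sin θ * Complex.I))‖ = r := by
  rw [LinearIsometryEquiv.norm_map, norm_mul, Complex.ofReal_cos, Complex.ofReal_sin,
    Complex.norm_cos_add_sin_mul_I, mul_one, Complex.norm_of_nonneg hr]

lemma lintegral_norm_plane {G : ℝ → ℝ≥0∞} (hG : Measurable G) :
    ∫⁻ x : Plane, G ‖x‖ = ENNReal.ofReal (2 * Real.pi) *
      ∫⁻ r in Set.Ioi (0 : ℝ), ENNReal.ofReal r * G r := by
  obtain ⟨T, -⟩ := exists_linearIsometryEquiv_complex 0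
  rw [lintegral_plane_eq_polar T (F := fun x => G ‖x‖) (hG.comp measurable_norm),
    ← lintegral_const_mul _ (by fun_prop)]
  refine setLIntegral_congr_fun measurableSet_Ioi fun r hr => ?_
  simp only [norm_polar T (le_of_lt hr)]
  rw [setLIntegral_const, Real.volume_Ioo, mul_comm (G r), mul_left_comm]
  congr 2
  ring

/-- `cos θ > c` describes the interval of angles of modulus less than `arccos c`, for all real `c`:
beyond `[-1, 1]` the convention for `arccos` gives the empty and the full interval. -/
lemma lt_cos_iff_abs_lt_arccos {θ c : ℝ} (hθ : |θ| < Real.pi) :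
    c < Real.cos θ ↔ |θ| < Real.arccos c := by
  rw [← Real.cos_abs]
  have h0 := abs_nonneg θ
  rcases lt_or_ge c (-1) with hc | hc
  · rw [Real.arccos_of_le_neg_one hc.le]
    exact ⟨fun _ => hθ, fun _ => hc.trans_le (Real.neg_one_le_cos _)⟩
  rcases lt_or_ge 1 c with hc1 | hc1
  · rw [Real.arccos_of_one_le hc1.le]
    exact ⟨fun h => absurd (h.trans_le (Real.cos_le_one _)) (not_lt.2 hc1.le),
      fun h => absurd h (not_lt.2 h0)⟩
  constructor
  · intro h
    rw [← Real.arccos_cos h0 hθ.le]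
    exact Real.strictAntiOn_arccos ⟨hc, hc1⟩ ⟨Real.neg_one_le_cos _, Real.cos_le_one _⟩ h
  · intro h
    rw [← Real.cos_arccos hc hc1]
    exact Real.strictAntiOn_cos ⟨h0, hθ.le⟩ ⟨Real.arccos_nonneg _, Real.arccos_le_pi _⟩ h

/-- The law of cosines: the circle of radius `r` around the origin meets the disk of radius `D`
around `y` in an arc of half-angle `arccos ((r ^ 2 + ‖y‖ ^ 2 - D ^ 2) / (2 * ‖y‖ * r))`. -/
lemma polar_mem_ball_iff {T : ℂ ≃ₗᵢ[ℝ] Plane} {y : Plane} (hT : T (‖y‖ : ℂ) = y) (hy : 0 < ‖y‖)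
    {D r θ : ℝ} (hD : 0 < D) (hr : 0 < r) (hθ : |θ| < Real.pi) :
    T (r * (Real.cos θ + Real.sin θ * Complex.I)) ∈ Metric.ball y D ↔
      |θ| < Real.arccos ((r ^ 2 + ‖y‖ ^ 2 - D ^ 2) / (2 * ‖y‖ * r)) := by
  rw [← lt_cos_iff_abs_lt_arccos hθ, Metric.mem_ball]
  nth_rw 1 [← hT]
  rw [LinearIsometryEquiv.dist_map, dist_eq_norm, ← sq_lt_sq₀ (norm_nonneg _) hD.le,
    Complex.sq_norm, Complex.normSq_apply, div_lt_iff₀ (by positivity)]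
  have h := Real.sin_sq_add_cos_sq θ
  simp only [Complex.sub_re, Complex.mul_re, Complex.ofReal_re, Complex.add_re, Complex.I_re,
    mul_zero, Complex.ofReal_im, Complex.I_im, mul_one, sub_self, add_zero, Complex.add_im,
    Complex.mul_im, zero_add, zero_mul, sub_zero, Complex.sub_im]
  have h2 : (r * Real.cos θ - ‖y‖) * (r * Real.cos θ - ‖y‖) + r * Real.sin θ * (r * Real.sin θ) =
      r ^ 2 + ‖y‖ ^ 2 - Real.cos θ * (2 * ‖y‖ * r) := by
    linear_combination r ^ 2 * h
  rw [h2]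
  constructor <;> intro h <;> linarith

lemma setLIntegral_ball_norm {G : ℝ → ℝ≥0∞} (hG : Measurable G) {y : Plane} (hy : 0 < ‖y‖)
    {D : ℝ} (hD : 0 < D) :
    ∫⁻ x in Metric.ball y D, G ‖x‖ = ∫⁻ r in Set.Ioi (0 : ℝ), ENNReal.ofReal r * (G r *
      ENNReal.ofReal (2 * Real.arccos ((r ^ 2 + ‖y‖ ^ 2 - D ^ 2) / (2 * ‖y‖ * r)))) := by
  obtain ⟨T, hT⟩ := exists_linearIsometryEquiv_complex y
  rw [← lintegral_indicator measurableSet_ball, lintegral_plane_eq_polar T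
    (F := (Metric.ball y D).indicator fun x => G ‖x‖)
    ((hG.comp measurable_norm).indicator measurableSet_ball)]
  refine setLIntegral_congr_fun measurableSet_Ioi fun r hr => ?_
  congr 1
  set a := Real.arccos ((r ^ 2 + ‖y‖ ^ 2 - D ^ 2) / (2 * ‖y‖ * r)) with ha
  have h1 : ∀ θ ∈ Set.Ioo (-Real.pi) Real.pi,
      (Metric.ball y D).indicator (fun x => G ‖x‖) (T (r * (Real.cos θ + Real.sin θ * Complex.I))) =
      (Set.Ioo (-a) a).indicator (fun _ => G r) θ := by
    intro θ hθ
    have h2 := polar_mem_ball_iff hT hy hD hr (abs_lt.2 hθ)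
    rw [← ha, abs_lt] at h2
    by_cases h : θ ∈ Set.Ioo (-a) a
    · rw [Set.indicator_of_mem h, Set.indicator_of_mem (h2.2 h), norm_polar T (le_of_lt hr)]
    · rw [Set.indicator_of_notMem h, Set.indicator_of_notMem fun h' => h (h2.1 h')]
  rw [setLIntegral_congr_fun measurableSet_Ioo h1, lintegral_indicator measurableSet_Ioo,
    setLIntegral_const, Measure.restrict_apply measurableSet_Ioo,
    Set.inter_eq_left.2, Real.volume_Ioo]
  · congr 2; ring
  · have := Real.arccos_le_pi ((r ^ 2 + ‖y‖ ^ 2 - D ^ 2) / (2 * ‖y‖ * r))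
    exact Set.Ioo_subset_Ioo (by linarith) this

/-- `lossDensity c α r = 1 - E exp (-c * h * r ^ (-α))` for `r > 0` and `h` exponential with mean
one. With `c = P * s`, the Laplace transform at `s` of the interference from a Poisson process of
density `lam` is `exp (-lam * ∫ x, lossDensity c α ‖x‖)`. -/
noncomputable def lossDensity (c α r : ℝ) : ℝ := 1 / (1 + r ^ α / c)

lemma lossDensity_pos {c α r : ℝ} (hc : 0 < c) (hr : 0 ≤ r) : 0 < lossDensity c α r := by
  unfold lossDensity
  have := Real.rpow_nonneg hr α
  positivity

lemma measurable_lossDensity (c α : ℝ) : Measurable (lossDensity c α) := by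
  unfold lossDensity
  fun_prop

/-- `∫ r / (1 + r ^ α / c)` is reduced to Gamma integrals by writing the denominator as
`∫ exp (-x * (1 + r ^ α / c))` and exchanging the integrals; the reflection formula then applies. -/
lemma lintegral_mul_lossDensity {c α : ℝ} (hc : 0 < c) (hα : 2 < α) :
    ∫⁻ r in Set.Ioi (0 : ℝ), ENNReal.ofReal r * ENNReal.ofReal (lossDensity c α r) =
      ENNReal.ofReal (c ^ (2 / α) / α * (Real.pi / Real.sin (Real.pi * (2 / α)))) := by
  have hα0 : 0 < α := by linarith
  have hq : 0 < 2 / α := by positivity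
  have hq1 : 0 < 1 - 2 / α := by rw [sub_pos, div_lt_one hα0]; exact hα
  have h1 : ∀ r ∈ Set.Ioi (0 : ℝ), ENNReal.ofReal r * ENNReal.ofReal (lossDensity c α r) =
      ∫⁻ x in Set.Ioi (0 : ℝ), ENNReal.ofReal (r * Real.exp (-x * (1 + r ^ α / c))) := by
    intro r hr
    have hr' : (0 : ℝ) < r := hr
    have h0 : 0 < 1 + r ^ α / c := by positivity
    rw [← ENNReal.ofReal_mul hr'.le]
    symm
    refine lintegral_ofReal_eq_of_integral_eq (Eventually.of_forall fun x => by positivity)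
      (mul_pos hr' (lossDensity_pos hc hr'.le)) ?_
    rw [integral_const_mul, lossDensity]
    congr 1
    have := integral_exp_mul_Ioi (a := -(1 + r ^ α / c)) (by linarith) 0
    simp only [mul_zero, Real.exp_zero] at this
    rw [neg_div_neg_eq] at this
    rw [← this]
    refine integral_congr_ae (Eventually.of_forall fun x => ?_)
    simp only
    congr 1; ring
  rw [setLIntegral_congr_fun measurableSet_Ioi h1, lintegral_lintegral_swap
    (Measurable.aemeasurable (by fun_prop))]
  have h2 : ∀ x ∈ Set.Ioi (0 : ℝ),
      ∫⁻ r in Set.Ioi (0 : ℝ), ENNReal.ofReal (r * Real.exp (-x * (1 + r ^ α / c))) =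
      ENNReal.ofReal (c ^ (2 / α) / α * Real.Gamma (2 / α) *
        (x ^ ((1 - 2 / α) - 1) * Real.exp (-(1 * x)))) := by
    intro x hx
    have hx' : (0 : ℝ) < x := hx
    have hG := Real.Gamma_pos_of_pos hq
    refine lintegral_ofReal_eq_of_integral_eq ?_ (by positivity) ?_
    · filter_upwards [ae_restrict_mem measurableSet_Ioi] with r hr
      exact mul_nonneg (le_of_lt hr) (Real.exp_pos _).le
    · have h3 := integral_rpow_mul_exp_neg_mul_rpow (p := α) (q := 1) (b := x / c) hα0
        (by norm_num) (by positivity)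
      have h4 : ∀ r : ℝ, r * Real.exp (-x * (1 + r ^ α / c)) =
          Real.exp (-x) * (r ^ (1 : ℝ) * Real.exp (-(x / c) * r ^ α)) := by
        intro r
        rw [Real.rpow_one, mul_left_comm, ← Real.exp_add]
        congr 2; ring
      simp_rw [h4]
      rw [integral_const_mul, h3, neg_div, Real.rpow_neg (by positivity),
        Real.div_rpow hx'.le hc.le, inv_div, show (1 : ℝ) + 1 = 2 by norm_num,
        show 1 - 2 / α - 1 = -(2 / α) by ring, Real.rpow_neg hx'.le, one_mul]
      ring
  rw [setLIntegral_congr_fun measurableSet_Ioi h2]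
  have hsin : 0 < Real.sin (Real.pi * (2 / α)) := by
    refine Real.sin_pos_of_pos_of_lt_pi (by positivity) ?_
    nlinarith [Real.pi_pos]
  refine lintegral_ofReal_eq_of_integral_eq ?_ (by positivity) ?_
  · filter_upwards [ae_restrict_mem measurableSet_Ioi] with x hx
    have hx' : (0 : ℝ) < x := hx
    have hG := Real.Gamma_pos_of_pos hq
    simp only [Pi.zero_apply]
    positivity
  · rw [integral_const_mul, Real.integral_rpow_mul_exp_neg_mul_Ioi hq1 one_pos,
      ← Real.Gamma_mul_Gamma_one_sub]
    simp only [div_one, Real.one_rpow]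
    ring

lemma lintegral_lossDensity_norm {c α : ℝ} (hc : 0 < c) (hα : 2 < α) :
    ∫⁻ x : Plane, ENNReal.ofReal (lossDensity c α ‖x‖) =
      ENNReal.ofReal (Real.pi * (c ^ (2 / α) / normalizedSinc (2 / α))) := by
  have hα0 : 0 < α := by linarith
  have hq : 0 < 2 / α := by positivity
  rw [lintegral_norm_plane (measurable_lossDensity c α).ennreal_ofReal,
    lintegral_mul_lossDensity hc hα, ← ENNReal.ofReal_mul (by positivity)]
  congr 1
  rw [normalizedSinc, Real.sinc_of_ne_zero (by positivity)]
  field_simp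

lemma normalizedSinc_pos {α : ℝ} (hα : 2 < α) : 0 < normalizedSinc (2 / α) := by
  have hα0 : 0 < α := by linarith
  have hq1 : 2 / α < 1 := by rw [div_lt_one hα0]; exact hα
  have hq : 0 < 2 / α := by positivity
  rw [normalizedSinc, Real.sinc_of_ne_zero (by positivity)]
  refine div_pos (Real.sin_pos_of_pos_of_lt_pi (by positivity) ?_) (by positivity)
  nlinarith [Real.pi_pos]

lemma integrable_lossDensity_norm {c α : ℝ} (hc : 0 < c) (hα : 2 < α) :
    Integrable fun x : Plane => lossDensity c α ‖x‖ := by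
  refine ⟨((measurable_lossDensity c α).comp measurable_norm).aestronglyMeasurable, ?_⟩
  rw [hasFiniteIntegral_iff_ofReal
    (Eventually.of_forall fun x => (lossDensity_pos hc (norm_nonneg x)).le),
    lintegral_lossDensity_norm hc hα]
  exact ENNReal.ofReal_lt_top

lemma integral_lossDensity_norm {c α : ℝ} (hc : 0 < c) (hα : 2 < α) :
    ∫ x : Plane, lossDensity c α ‖x‖ = Real.pi * (c ^ (2 / α) / normalizedSinc (2 / α)) := by
  have := normalizedSinc_pos hα
  rw [integral_eq_lintegral_of_nonneg_ae
    (Eventually.of_forall fun x => (lossDensity_pos hc (norm_nonneg x)).le)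
    (integrable_lossDensity_norm hc hα).1, lintegral_lossDensity_norm hc hα,
    ENNReal.toReal_ofReal (by positivity)]

/-! ### The exponent of a single hole -/

/-- A circle of radius `r` around the origin meets the disk only if `v - D < r < v + D`; otherwise
the arc has angle zero, by the convention for `arccos` beyond `1`. -/
lemma arccos_eq_zero_of_notMem_Ioc {v D r : ℝ} (hD : 0 < D) (hv : D < v) (hr : 0 < r)
    (hrn : r ∉ Set.Ioc (v - D) (v + D)) :
    Real.arccos ((r ^ 2 + v ^ 2 - D ^ 2) / (2 * v * r)) = 0 := by
  have hv0 : 0 < v := hD.trans hv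
  refine Real.arccos_of_one_le ?_
  rw [one_le_div (by positivity)]
  rw [Set.mem_Ioc, not_and_or, not_lt, not_le] at hrn
  rcases hrn with h | h <;> nlinarith

lemma holeExponent_eq_toReal {lam₂ P α D s v : ℝ} (hP : 0 < P) (hs : 0 < s) (hD : 0 < D)
    (hv : D < v) :
    holeExponent lam₂ P α D s v =
      lam₂ * (∫⁻ r in Set.Ioi (0 : ℝ), ENNReal.ofReal r *
        (ENNReal.ofReal (lossDensity (P * s) α r) *
          ENNReal.ofReal (2 * Real.arccos ((r ^ 2 + v ^ 2 - D ^ 2) / (2 * v * r))))).toReal := by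
  have hc : 0 < P * s := by positivity
  have hsub : Set.Ioc (v - D) (v + D) ⊆ Set.Ioi 0 := fun r hr => by
    have := hr.1
    simp only [Set.mem_Ioi]
    linarith
  let F : ℝ → ℝ := fun r =>
    r * (lossDensity (P * s) α r * (2 * Real.arccos ((r ^ 2 + v ^ 2 - D ^ 2) / (2 * v * r))))
  have hF : Measurable F := by
    refine measurable_id.mul ((measurable_lossDensity _ α).mul (Measurable.const_mul ?_ 2))
    exact Real.continuous_arccos.measurable.comp (by fun_prop)
  have hnn : ∀ r ∈ Set.Ioi (0 : ℝ), 0 ≤ F r := fun r hr =>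
    mul_nonneg (le_of_lt hr) (mul_nonneg (lossDensity_pos hc (le_of_lt hr)).le
      (mul_nonneg zero_le_two (Real.arccos_nonneg _)))
  have h1 : holeExponent lam₂ P α D s v = lam₂ * ∫ r in Set.Ioc (v - D) (v + D), F r := by
    rw [holeExponent, intervalIntegral.integral_of_le (by linarith), ← integral_const_mul]
    refine integral_congr_ae (Eventually.of_forall fun r => ?_)
    simp only [lossDensity, F]
    ring
  have h2 : ∫⁻ r in Set.Ioc (v - D) (v + D), ENNReal.ofReal (F r) =
      ∫⁻ r in Set.Ioi (0 : ℝ), ENNReal.ofReal (F r) := by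
    rw [← lintegral_indicator measurableSet_Ioc, ← lintegral_indicator measurableSet_Ioi]
    refine lintegral_congr fun r => ?_
    by_cases hrI : r ∈ Set.Ioc (v - D) (v + D)
    · rw [Set.indicator_of_mem hrI, Set.indicator_of_mem (hsub hrI)]
    by_cases hr : r ∈ Set.Ioi (0 : ℝ)
    · rw [Set.indicator_of_notMem hrI, Set.indicator_of_mem hr]
      simp only [F]
      rw [arccos_eq_zero_of_notMem_Ioc hD hv hr hrI]
      simp
    · rw [Set.indicator_of_notMem hrI, Set.indicator_of_notMem hr]
  have h3 : ∀ r ∈ Set.Ioi (0 : ℝ), ENNReal.ofReal (F r) = ENNReal.ofReal r *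
        (ENNReal.ofReal (lossDensity (P * s) α r) *
          ENNReal.ofReal (2 * Real.arccos ((r ^ 2 + v ^ 2 - D ^ 2) / (2 * v * r)))) := by
    intro r hr
    simp only [F]
    rw [ENNReal.ofReal_mul (le_of_lt hr), ENNReal.ofReal_mul (lossDensity_pos hc (le_of_lt hr)).le]
  rw [h1, ← setLIntegral_congr_fun measurableSet_Ioi h3, ← h2,
    integral_eq_lintegral_of_nonneg_ae _ hF.aestronglyMeasurable]
  filter_upwards [ae_restrict_mem measurableSet_Ioc] with r hr using hnn r (hsub hr)

/-- The exponent of a hole is the integral of the loss density over the disk that it removes. -/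
lemma holeExponent_norm {lam₂ P α D s : ℝ} (hP : 0 < P) (hs : 0 < s) (hD : 0 < D)
    {y : Plane} (hy : D < ‖y‖) :
    holeExponent lam₂ P α D s ‖y‖ =
      lam₂ * ∫ x in Metric.ball y D, lossDensity (P * s) α ‖x‖ := by
  have hc : 0 < P * s := by positivity
  have h1 : 0 ≤ᵐ[volume.restrict (Metric.ball y D)] fun x : Plane => lossDensity (P * s) α ‖x‖ :=
    Eventually.of_forall fun x => (lossDensity_pos hc (norm_nonneg x)).le
  have h2 : Measurable fun x : Plane => lossDensity (P * s) α ‖x‖ :=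
    (measurable_lossDensity _ α).comp measurable_norm
  have h3 := setLIntegral_ball_norm (measurable_lossDensity (P * s) α).ennreal_ofReal
    (hD.trans hy) hD
  rw [holeExponent_eq_toReal hP hs hD hy, integral_eq_lintegral_of_nonneg_ae h1
    h2.aestronglyMeasurable, h3]

/-! ### Exponential fading -/

lemma lintegral_expMeasure_one {f : ℝ → ℝ≥0∞} (hf : Measurable f) :
    ∫⁻ x, f x ∂(expMeasure 1) = ∫⁻ x in Set.Ioi (0 : ℝ), ENNReal.ofReal (Real.exp (-x)) * f x := by
  have h1 : expMeasure 1 = volume.withDensity (exponentialPDF 1) := rfl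
  have h2 : Measurable (exponentialPDF 1) := (measurable_exponentialPDFReal 1).ennreal_ofReal
  rw [h1, lintegral_withDensity_eq_lintegral_mul _ h2 hf, restrict_Ioi_eq_restrict_Ici,
    ← lintegral_indicator measurableSet_Ici]
  refine lintegral_congr fun x => ?_
  by_cases hx : 0 ≤ x
  · rw [Set.indicator_of_mem (Set.mem_Ici.2 hx), Pi.mul_apply, exponentialPDF_of_nonneg hx]
    simp
  · rw [Set.indicator_of_notMem (by simpa using hx), Pi.mul_apply,
      exponentialPDF_of_neg (not_le.1 hx), zero_mul]

lemma lintegral_exp_neg_mul_expMeasure {a : ℝ} (ha : 0 ≤ a) :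
    ∫⁻ x, ENNReal.ofReal (Real.exp (-(a * x))) ∂(expMeasure 1) = ENNReal.ofReal (1 / (1 + a)) := by
  rw [lintegral_expMeasure_one (by fun_prop)]
  simp_rw [← ENNReal.ofReal_mul (Real.exp_pos _).le, ← Real.exp_add]
  refine lintegral_ofReal_eq_of_integral_eq (Eventually.of_forall fun x => by positivity)
    (by positivity) ?_
  have := integral_exp_mul_Ioi (a := -(1 + a)) (by linarith) 0
  simp only [mul_zero, Real.exp_zero] at this
  rw [neg_div_neg_eq] at this
  rw [← this]
  refine integral_congr_ae (Eventually.of_forall fun x => ?_)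
  simp only
  congr 1; ring

lemma lintegral_ofReal_expMeasure : ∫⁻ x, ENNReal.ofReal x ∂(expMeasure 1) = 1 := by
  rw [lintegral_expMeasure_one (by fun_prop), ← ENNReal.ofReal_one]
  simp_rw [← ENNReal.ofReal_mul (Real.exp_pos _).le]
  refine lintegral_ofReal_eq_of_integral_eq ?_ one_pos ?_
  · filter_upwards [ae_restrict_mem measurableSet_Ioi] with x hx
    exact mul_nonneg (Real.exp_pos _).le (le_of_lt hx)
  · have := Real.Gamma_eq_integral (s := 2) two_pos
    rw [Real.Gamma_two] at this
    rw [this]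
    norm_num

lemma ae_nonneg_expMeasure : ∀ᵐ x ∂(expMeasure 1), 0 ≤ x := by
  have h1 := lintegral_expMeasure_one (f := (Set.Iio (0 : ℝ)).indicator 1)
    (measurable_one.indicator measurableSet_Iio)
  rw [lintegral_indicator_one measurableSet_Iio, setLIntegral_congr_fun (g := fun _ => 0)
    measurableSet_Ioi, lintegral_zero] at h1
  · rw [ae_iff]
    simp only [not_le]
    exact h1
  · intro x hx
    have : x ∉ Set.Iio (0 : ℝ) := fun h => lt_asymm (Set.mem_Iio.1 h) hx
    simp only [Set.indicator_of_notMem this, mul_zero]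

/-- Fubini's theorem for independent random variables. -/
lemma lintegral_comp_indepFun {Ω 𝓤 𝓥 : Type*} [MeasurableSpace Ω] [MeasurableSpace 𝓤]
    [MeasurableSpace 𝓥] {μ : Measure Ω} [IsProbabilityMeasure μ] {U : Ω → 𝓤} {V : Ω → 𝓥}
    (hU : Measurable U) (hV : Measurable V) (hUV : IndepFun U V μ) {F : 𝓤 × 𝓥 → ℝ≥0∞}
    (hF : Measurable F) :
    ∫⁻ ω, F (U ω, V ω) ∂μ = ∫⁻ ω, ∫⁻ ω', F (U ω', V ω) ∂μ ∂μ := by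
  have : IsProbabilityMeasure (μ.map U) := Measure.isProbabilityMeasure_map hU.aemeasurable
  have : IsProbabilityMeasure (μ.map V) := Measure.isProbabilityMeasure_map hV.aemeasurable
  rw [← lintegral_map hF (hU.prodMk hV),
    (indepFun_iff_map_prod_eq_prod_map_map hU.aemeasurable hV.aemeasurable).1 hUV,
    lintegral_prod_symm _ hF.aemeasurable, lintegral_map hF.lintegral_prod_left' hV]
  refine lintegral_congr fun ω => ?_
  rw [lintegral_map (f := fun u => F (u, V ω))
    (hF.comp (measurable_id.prodMk measurable_const)) hU]

lemma setLIntegral_comp_indepFun {Ω 𝓤 𝓥 : Type*} [MeasurableSpace Ω] [MeasurableSpace 𝓤]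
    [MeasurableSpace 𝓥] {μ : Measure Ω} [IsProbabilityMeasure μ] {U : Ω → 𝓤} {V : Ω → 𝓥}
    (hU : Measurable U) (hV : Measurable V) (hUV : IndepFun U V μ) {F : 𝓤 × 𝓥 → ℝ≥0∞}
    (hF : Measurable F) {A : Set 𝓥} (hA : MeasurableSet A) :
    ∫⁻ ω in V ⁻¹' A, F (U ω, V ω) ∂μ = ∫⁻ ω in V ⁻¹' A, ∫⁻ ω', F (U ω', V ω) ∂μ ∂μ := by
  have h1 := lintegral_comp_indepFun hU hV hUV (hF.indicator (measurable_snd hA))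
  rw [← lintegral_indicator (hV hA), ← lintegral_indicator (hV hA)]
  refine Eq.trans ?_ (h1.trans ?_)
  · rfl
  · refine lintegral_congr fun ω => ?_
    by_cases hω : V ω ∈ A
    · rw [Set.indicator_of_mem (show ω ∈ V ⁻¹' A from hω)]
      refine lintegral_congr fun ω' => ?_
      rw [Set.indicator_of_mem (show (U ω', V ω) ∈ Prod.snd ⁻¹' A from hω)]
    · rw [Set.indicator_of_notMem (show ω ∉ V ⁻¹' A from hω), ← lintegral_zero]
      refine lintegral_congr fun ω' => ?_
      rw [Set.indicator_of_notMem (show (U ω', V ω) ∉ Prod.snd ⁻¹' A from hω)]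

namespace IsRayleighFading

variable {Ω : Type*} [MeasurableSpace Ω] {μ : Measure Ω} {h : ℕ → Ω → ℝ}

lemma ae_nonneg (hh : IsRayleighFading μ h) : ∀ᵐ ω ∂μ, ∀ n, 0 ≤ h n ω := by
  rw [ae_all_iff]
  intro n
  have h1 := ae_nonneg_expMeasure
  rw [← hh.law n] at h1
  exact ae_of_ae_map (hh.measurable n).aemeasurable h1

/-- The Laplace transform of finitely many independent exponential variables. -/
lemma lintegral_prod_exp (hh : IsRayleighFading μ h) {a : ℕ → ℝ} (ha : ∀ n, 0 ≤ a n) (N : ℕ) :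
    ∫⁻ ω, ∏ n ∈ Finset.range N, ENNReal.ofReal (Real.exp (-(a n * h n ω))) ∂μ =
      ∏ n ∈ Finset.range N, ENNReal.ofReal (1 / (1 + a n)) := by
  have hm : ∀ n, Measurable fun t : ℝ => ENNReal.ofReal (Real.exp (-(a n * t))) := fun n => by
    fun_prop
  rw [lintegral_prod_eq_prod_lintegral_of_indepFun _
    (fun n ω => ENNReal.ofReal (Real.exp (-(a n * h n ω)))) (hh.indep.comp _ hm)
    (fun n => (hm n).comp (hh.measurable n))]
  refine Finset.prod_congr rfl fun n _ => ?_
  rw [← lintegral_exp_neg_mul_expMeasure (ha n), ← hh.law n,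
    lintegral_map (hm n) (hh.measurable n)]

end IsRayleighFading

/-! ### Convergence of the interference -/

/-- The path gain from a point `z`, with transmit power `P`, in the presence of the hole centres
`y n`: it vanishes inside the holes. -/
noncomputable def pathGain (P α D : ℝ) (y : ℕ → Plane) (z : Plane) : ℝ :=
  (⋃ n, Metric.ball (y n) D)ᶜ.indicator (fun x => P * ‖x‖ ^ (-α)) z

lemma pathGain_nonneg {P : ℝ} (hP : 0 ≤ P) (α D : ℝ) (y : ℕ → Plane) (z : Plane) :
    0 ≤ pathGain P α D y z :=
  Set.indicator_nonneg (fun _ _ => mul_nonneg hP (Real.rpow_nonneg (norm_nonneg _) _)) _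

lemma pathGain_le {P : ℝ} (hP : 0 ≤ P) (α D : ℝ) (y : ℕ → Plane) (z : Plane) :
    pathGain P α D y z ≤ P * ‖z‖ ^ (-α) :=
  Set.indicator_le_self' (fun _ _ => mul_nonneg hP (Real.rpow_nonneg (norm_nonneg _) _)) _

lemma measurable_pathGain (P α D : ℝ) :
    Measurable fun p : (ℕ → Plane) × Plane => pathGain P α D p.1 p.2 := by
  have h1 : MeasurableSet {p : (ℕ → Plane) × Plane | p.2 ∈ (⋃ n, Metric.ball (p.1 n) D)ᶜ} := by
    have : {p : (ℕ → Plane) × Plane | p.2 ∈ (⋃ n, Metric.ball (p.1 n) D)ᶜ} =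
        (⋃ n, {p | dist p.2 (p.1 n) < D})ᶜ := by
      ext p; simp
    rw [this]
    refine (MeasurableSet.iUnion fun n => measurableSet_lt ?_ measurable_const).compl
    exact measurable_snd.dist ((measurable_pi_apply n).comp measurable_fst)
  exact Measurable.indicator (f := fun p : (ℕ → Plane) × Plane => P * ‖p.2‖ ^ (-α))
    (by fun_prop) h1

lemma receivedPower_eq {Ω : Type*} (X Y : ℕ → Ω → Plane) (h : ℕ → Ω → ℝ) (P α D : ℝ) (ω : Ω)
    (n : ℕ) :
    receivedPower X Y h P α D ω n = pathGain P α D (fun k => Y k ω) (X n ω) * h n ω := by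
  unfold receivedPower pathGain
  by_cases hx : X n ω ∈ (holeRegion Y D ω)ᶜ
  · rw [Set.indicator_of_mem hx, Set.indicator_of_mem (show X n ω ∈ (⋃ k, _)ᶜ from hx)]
    ring
  · rw [Set.indicator_of_notMem hx, Set.indicator_of_notMem (show X n ω ∉ (⋃ k, _)ᶜ from hx),
      zero_mul]

section Interference

variable {Ω : Type*} [MeasurableSpace Ω] {μ : Measure Ω} {Y X : ℕ → Ω → Plane} {h : ℕ → Ω → ℝ}
  {P α D : ℝ}

/-- By Campbell's formula the interference from beyond distance `1` has finite mean; only finitely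
many points are closer. -/
lemma ae_summable_receivedPower [IsProbabilityMeasure μ] {lam : ℝ} (hP : 0 < P) (hα : 2 < α)
    (hX : IsPoissonPointProcess μ X lam) (hh : IsRayleighFading μ h)
    (hhX : IndepFun (fun ω n => h n ω) (fun ω n => X n ω) μ) :
    ∀ᵐ ω ∂μ, Summable (receivedPower X Y h P α D ω) := by
  let φ : Plane → ℝ := (Metric.ball (0 : Plane) 1)ᶜ.indicator fun x => ‖x‖ ^ (-α)
  have hφm : Measurable φ := Measurable.indicator (by fun_prop) measurableSet_ball.compl
  have hφ0 : ∀ x, 0 ≤ φ x := Set.indicator_nonneg fun _ _ => Real.rpow_nonneg (norm_nonneg _) _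
  have hφle : ∀ x, φ x ≤ 2 * lossDensity 1 α ‖x‖ := by
    intro x
    have hpos := lossDensity_pos (α := α) one_pos (norm_nonneg x)
    by_cases hx : x ∈ (Metric.ball (0 : Plane) 1)ᶜ
    · simp only [φ]
      rw [Set.indicator_of_mem hx]
      have hx1 : 1 ≤ ‖x‖ := by simpa using hx
      have h1 : 1 ≤ ‖x‖ ^ α := Real.one_le_rpow hx1 (by linarith)
      rw [Real.rpow_neg (norm_nonneg _), lossDensity, div_one, mul_one_div, inv_eq_one_div,
        div_le_div_iff₀ (by linarith) (by linarith)]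
      linarith
    · simp only [φ]
      rw [Set.indicator_of_notMem hx]
      positivity
  have hφi : ∫⁻ x, ENNReal.ofReal (φ x) < ∞ := by
    refine (lintegral_mono fun x => ENNReal.ofReal_le_ofReal (hφle x)).trans_lt ?_
    exact ((integrable_lossDensity_norm one_pos hα).const_mul 2).lintegral_lt_top
  have hfar : ∀ᵐ ω ∂μ, ∑' n, ENNReal.ofReal (h n ω) * ENNReal.ofReal (φ (X n ω)) < ∞ := by
    have hm : ∀ n, Measurable fun ω => ENNReal.ofReal (h n ω) * ENNReal.ofReal (φ (X n ω)) :=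
      fun n => (hh.measurable n).ennreal_ofReal.mul (hφm.comp (hX.measurable n)).ennreal_ofReal
    refine ae_lt_top (Measurable.tsum hm) ?_
    rw [lintegral_tsum fun n => (hm n).aemeasurable]
    have hgm : ∀ n : ℕ, Measurable fun t : ℕ → ℝ => ENNReal.ofReal (t n) := fun n =>
      (measurable_pi_apply n).ennreal_ofReal
    have hφn : ∀ n : ℕ, Measurable fun x : ℕ → Plane => ENNReal.ofReal (φ (x n)) := fun n =>
      (Measurable.comp (g := φ) hφm (measurable_pi_apply n)).ennreal_ofReal
    have h1 : ∀ n, ∫⁻ ω, ENNReal.ofReal (h n ω) * ENNReal.ofReal (φ (X n ω)) ∂μ =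
        ∫⁻ ω, ENNReal.ofReal (φ (X n ω)) ∂μ := by
      intro n
      have h2 := lintegral_mul_eq_lintegral_mul_lintegral_of_indepFun (μ := μ)
        (f := fun ω => ENNReal.ofReal (h n ω)) (g := fun ω => ENNReal.ofReal (φ (X n ω)))
        (hh.measurable n).ennreal_ofReal (hφm.comp (hX.measurable n)).ennreal_ofReal
        (hhX.comp (hgm n) (hφn n))
      have h3 : ∫⁻ ω, ENNReal.ofReal (h n ω) ∂μ = 1 := by
        rw [← lintegral_map (f := ENNReal.ofReal) ENNReal.measurable_ofReal (hh.measurable n),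
          hh.law n, lintegral_ofReal_expMeasure]
      rw [h3, one_mul] at h2
      exact h2
    simp_rw [h1]
    rw [hX.tsum_lintegral (φ := fun x => ENNReal.ofReal (φ x)) hφm.ennreal_ofReal]
    exact ENNReal.mul_ne_top ENNReal.ofReal_ne_top hφi.ne
  filter_upwards [hfar, hh.ae_nonneg,
    hX.ae_pointCount_ne_top measurableSet_ball (Metric.isBounded_ball (x := (0 : Plane)) (r := 1))]
    with ω h1 h2 h3
  have hs : Summable fun n => P * (h n ω * φ (X n ω)) := by
    refine Summable.mul_left P ?_
    have h4 := ENNReal.summable_toReal h1.ne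
    refine h4.congr fun n => ?_
    rw [ENNReal.toReal_mul, ENNReal.toReal_ofReal (h2 n), ENNReal.toReal_ofReal (hφ0 _)]
  refine hs.of_norm_bounded_eventually ?_
  have h5 : {n : ℕ | X n ω ∈ Metric.ball (0 : Plane) 1}.Finite := Set.encard_ne_top_iff.1 h3
  filter_upwards [h5.eventually_cofinite_notMem] with n hn
  rw [receivedPower_eq, Real.norm_of_nonneg (mul_nonneg (pathGain_nonneg hP.le _ _ _ _) (h2 n))]
  simp only [φ]
  rw [Set.indicator_of_mem (show X n ω ∈ (Metric.ball (0 : Plane) 1)ᶜ from hn)]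
  calc _ ≤ P * ‖X n ω‖ ^ (-α) * h n ω :=
        mul_le_mul_of_nonneg_right (pathGain_le hP.le _ _ _ _) (h2 n)
    _ = _ := by ring

lemma measurable_receivedPower (hY : ∀ n, Measurable (Y n)) (hX : ∀ n, Measurable (X n))
    (hh : ∀ n, Measurable (h n)) (n : ℕ) :
    Measurable fun ω => receivedPower X Y h P α D ω n := by
  simp_rw [receivedPower_eq]
  exact ((measurable_pathGain P α D).comp
    ((measurable_pi_lambda _ fun k => hY k).prodMk (hX n))).mul (hh n)

lemma aemeasurable_interference (hY : ∀ n, Measurable (Y n)) (hX : ∀ n, Measurable (X n))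
    (hh : ∀ n, Measurable (h n)) (hs : ∀ᵐ ω ∂μ, Summable (receivedPower X Y h P α D ω)) :
    AEMeasurable (interference X Y h P α D) μ := by
  refine aemeasurable_of_tendsto_metrizable_ae' (f := fun N ω => ∑ n ∈ Finset.range N,
    receivedPower X Y h P α D ω n) (fun N => ?_) ?_
  · exact (Finset.measurable_sum _ fun n _ => measurable_receivedPower hY hX hh n).aemeasurable
  · filter_upwards [hs] with ω hω using hω.hasSum.tendsto_sum_nat

end Interference

/-! ### The hole centres held fixed -/

/-- The Laplace transform at `s`, averaged over the fading, of the power received from a point `z`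
of the baseline process when the hole centres are `y`. -/
noncomputable def fadingFactor (P α D s : ℝ) (y : ℕ → Plane) (z : Plane) : ℝ≥0 :=
  Real.toNNReal (1 / (1 + s * pathGain P α D y z))

section FadingFactor

variable {P α D s : ℝ}

lemma coe_fadingFactor (hP : 0 < P) (hs : 0 < s) (y : ℕ → Plane) (z : Plane) :
    (fadingFactor P α D s y z : ℝ) = 1 / (1 + s * pathGain P α D y z) := by
  have := mul_nonneg hs.le (pathGain_nonneg hP.le α D y z)
  exact Real.coe_toNNReal _ (by positivity)

lemma fadingFactor_le_one (hP : 0 < P) (hs : 0 < s) (y : ℕ → Plane) (z : Plane) :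
    fadingFactor P α D s y z ≤ 1 := by
  have := mul_nonneg hs.le (pathGain_nonneg hP.le α D y z)
  rw [← NNReal.coe_le_coe, coe_fadingFactor hP hs, NNReal.coe_one, div_le_one (by positivity)]
  linarith

lemma measurable_fadingFactor (P α D s : ℝ) :
    Measurable fun p : (ℕ → Plane) × Plane => fadingFactor P α D s p.1 p.2 :=
  Measurable.real_toNNReal
    (measurable_const.div (measurable_const.add ((measurable_pathGain P α D).const_mul s)))

lemma measurable_fadingFactor_right (P α D s : ℝ) (y : ℕ → Plane) :
    Measurable (fadingFactor P α D s y) :=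
  Measurable.comp (g := fun p : (ℕ → Plane) × Plane => fadingFactor P α D s p.1 p.2)
    (f := fun z => (y, z)) (measurable_fadingFactor P α D s) measurable_prodMk_left

/-- The origin is excluded because `0 ^ (-α) = 0` for the real power function. -/
lemma one_sub_fadingFactor (hP : 0 < P) (hs : 0 < s) (y : ℕ → Plane) {z : Plane} (hz : z ≠ 0) :
    1 - (fadingFactor P α D s y z : ℝ) =
      (⋃ n, Metric.ball (y n) D)ᶜ.indicator (fun x => lossDensity (P * s) α ‖x‖) z := by
  rw [coe_fadingFactor hP hs, pathGain]
  by_cases h : z ∈ (⋃ n, Metric.ball (y n) D)ᶜ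
  · rw [Set.indicator_of_mem h, Set.indicator_of_mem h, lossDensity,
      Real.rpow_neg (norm_nonneg _)]
    have hr : 0 < ‖z‖ ^ α := Real.rpow_pos_of_pos (norm_pos_iff.2 hz) _
    field_simp
    ring
  · rw [Set.indicator_of_notMem h, Set.indicator_of_notMem h]
    norm_num

lemma one_sub_fadingFactor_ae (hP : 0 < P) (hs : 0 < s) (y : ℕ → Plane) :
    (fun z => 1 - (fadingFactor P α D s y z : ℝ)) =ᵐ[volume]
      (⋃ n, Metric.ball (y n) D)ᶜ.indicator (fun x => lossDensity (P * s) α ‖x‖) := by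
  have h0 : ∀ᵐ z : Plane, z ≠ 0 := by
    rw [ae_iff]; simp
  filter_upwards [h0] with z hz using one_sub_fadingFactor hP hs y hz

lemma measurableSet_iUnion_ball (y : ℕ → Plane) (D : ℝ) :
    MeasurableSet (⋃ n, Metric.ball (y n) D) :=
  MeasurableSet.iUnion fun _ => measurableSet_ball

lemma integrable_one_sub_fadingFactor (hP : 0 < P) (hs : 0 < s) (hα : 2 < α) (y : ℕ → Plane) :
    Integrable fun z => 1 - (fadingFactor P α D s y z : ℝ) :=
  ((integrable_lossDensity_norm (mul_pos hP hs) hα).indicator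
    (measurableSet_iUnion_ball y D).compl).congr (one_sub_fadingFactor_ae hP hs y).symm

lemma integral_one_sub_fadingFactor (hP : 0 < P) (hs : 0 < s) (hα : 2 < α) (y : ℕ → Plane) :
    ∫ z, (1 - (fadingFactor P α D s y z : ℝ)) =
      (∫ x : Plane, lossDensity (P * s) α ‖x‖) -
        ∫ x in ⋃ n, Metric.ball (y n) D, lossDensity (P * s) α ‖x‖ := by
  rw [integral_congr_ae (one_sub_fadingFactor_ae hP hs y),
    integral_indicator (measurableSet_iUnion_ball y D).compl,
    setIntegral_compl (measurableSet_iUnion_ball y D)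
      (integrable_lossDensity_norm (mul_pos hP hs) hα)]

end FadingFactor

/-- The mass of a union of disks is at most the sum of their masses, in exponential form. The
product over the disks may be infinite. -/
lemma ofReal_exp_setIntegral_iUnion_ball_le {F : Plane → ℝ} (hF : Integrable F)
    (hF0 : ∀ x, 0 ≤ F x) {c : ℝ} (hc : 0 ≤ c) (y : ℕ → Plane) (D : ℝ) :
    ENNReal.ofReal (Real.exp (c * ∫ x in ⋃ n, Metric.ball (y n) D, F x)) ≤
      ⨆ N, ∏ n ∈ Finset.range N,
        ENNReal.ofReal (Real.exp (c * ∫ x in Metric.ball (y n) D, F x)) := by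
  let S : ℕ → Set Plane := fun N => ⋃ n ∈ Finset.range N, Metric.ball (y n) D
  have hSm : ∀ N, MeasurableSet (S N) := fun N =>
    Finset.measurableSet_biUnion _ fun n _ => measurableSet_ball
  have hSmono : Monotone S := fun M N hMN =>
    Set.biUnion_subset_biUnion_left fun n hn => Finset.range_mono hMN hn
  have hSU : ⋃ N, S N = ⋃ n, Metric.ball (y n) D := by
    ext x
    simp only [S, Set.mem_iUnion, Finset.mem_range, exists_prop]
    exact ⟨fun ⟨_, n, _, h⟩ => ⟨n, h⟩, fun ⟨n, h⟩ => ⟨n + 1, n, n.lt_succ_self, h⟩⟩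
  have hle : ∀ N, ∫ x in S N, F x ≤ ∑ n ∈ Finset.range N, ∫ x in Metric.ball (y n) D, F x := by
    intro N
    induction N with
    | zero => simp [S]
    | succ N ih =>
      have h1 : S (N + 1) = S N ∪ Metric.ball (y N) D := by
        simp only [S, Finset.range_add_one, Finset.set_biUnion_insert]
        rw [Set.union_comm]
      rw [Finset.sum_range_succ, h1, ← Set.union_sdiff_self,
        setIntegral_union disjoint_sdiff_self_right (measurableSet_ball.diff (hSm N))
          hF.integrableOn hF.integrableOn]
      refine add_le_add ih ?_
      exact setIntegral_mono_set hF.integrableOn (ae_of_all _ hF0)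
        (Eventually.of_forall Set.sdiff_subset)
  have hlim : Tendsto (fun N => ENNReal.ofReal (Real.exp (c * ∫ x in S N, F x))) atTop
      (𝓝 (ENNReal.ofReal (Real.exp (c * ∫ x in ⋃ n, Metric.ball (y n) D, F x)))) := by
    rw [← hSU]
    exact ENNReal.tendsto_ofReal ((Real.continuous_exp.tendsto _).comp
      ((tendsto_setIntegral_of_monotone hSm hSmono hF.integrableOn).const_mul c))
  refine le_of_tendsto' hlim fun N => ?_
  refine le_trans ?_ (le_iSup _ N)
  rw [← ENNReal.ofReal_prod_of_nonneg fun _ _ => (Real.exp_pos _).le, ← Real.exp_sum,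
    ← Finset.mul_sum]
  exact ENNReal.ofReal_le_ofReal (Real.exp_le_exp.2 (mul_le_mul_of_nonneg_left (hle N) hc))

/-! ### Averaging over the fading and the baseline process -/

lemma originOutsideHoles_eq {Ω : Type*} (Y : ℕ → Ω → Plane) (D : ℝ) :
    originOutsideHoles Y D = {ω | ∀ n, Y n ω ∉ Metric.ball (0 : Plane) D} := by
  ext ω
  simp [originOutsideHoles, holeRegion]

section Laplace

variable {Ω : Type*} [MeasurableSpace Ω] {μ : Measure Ω}
  {lam₁ lam₂ P α D s : ℝ} {Y X : ℕ → Ω → Plane} {h : ℕ → Ω → ℝ}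

lemma measurableSet_originOutsideHoles (hY : ∀ n, Measurable (Y n)) :
    MeasurableSet (originOutsideHoles Y D) := by
  have : originOutsideHoles Y D = ⋂ n, Y n ⁻¹' (Metric.ball (0 : Plane) D)ᶜ := by
    rw [originOutsideHoles_eq]; ext; simp
  rw [this]
  exact MeasurableSet.iInter fun n => hY n measurableSet_ball.compl

lemma measure_originOutsideHoles (hlam₁ : 0 < lam₁) (hD : 0 < D)
    (hY : IsPoissonPointProcess μ Y lam₁) :
    μ (originOutsideHoles Y D) = ENNReal.ofReal (Real.exp (-(lam₁ * (Real.pi * D ^ 2)))) := by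
  have h1 := hY.count_law (Metric.ball 0 D) measurableSet_ball Metric.isBounded_ball 0
  have h2 : originOutsideHoles Y D = {ω | pointCount Y (Metric.ball 0 D) ω = (0 : ℕ)} := by
    rw [originOutsideHoles_eq]
    ext ω
    simp only [Set.mem_ofPred_eq, pointCount, Nat.cast_zero, Set.encard_eq_zero,
      Set.eq_empty_iff_forall_notMem]
  rw [h2, h1, poissonMeasure_singleton, EuclideanSpace.volume_ball_fin_two]
  congr 1
  have : ((ENNReal.ofReal D ^ 2 * ENNReal.ofReal Real.pi).toNNReal : ℝ) = Real.pi * D ^ 2 := by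
    rw [ENNReal.coe_toNNReal_eq_toReal, ENNReal.toReal_mul, ENNReal.toReal_pow,
      ENNReal.toReal_ofReal hD.le, ENNReal.toReal_ofReal Real.pi_pos.le, mul_comm]
  simp [Real.coe_toNNReal _ hlam₁.le]
  left
  simpa using this

/-- The configurations of hole centres for which the origin lies outside the holes. -/
def originFree (D : ℝ) : Set (ℕ → Plane) := {y | ∀ n, y n ∉ Metric.ball (0 : Plane) D}

lemma measurableSet_originFree (D : ℝ) : MeasurableSet (originFree D) := by
  have : originFree D = ⋂ n, (fun y : ℕ → Plane => y n) ⁻¹' (Metric.ball (0 : Plane) D)ᶜ := by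
    ext; simp [originFree]
  rw [this]
  exact MeasurableSet.iInter fun n => measurable_pi_apply n measurableSet_ball.compl

/-- Averaging over the fading, for finitely many points. -/
lemma setLIntegral_exp_interference_le_prod [IsProbabilityMeasure μ] (hP : 0 < P) (hs : 0 < s)
    (hY : ∀ n, Measurable (Y n)) (hX : ∀ n, Measurable (X n)) (hh : IsRayleighFading μ h)
    (hhYX : IndepFun (fun ω n => h n ω) (fun ω => (fun n => Y n ω, fun n => X n ω)) μ)
    (hsum : ∀ᵐ ω ∂μ, Summable (receivedPower X Y h P α D ω)) (N : ℕ) :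
    ∫⁻ ω in originOutsideHoles Y D,
        ENNReal.ofReal (Real.exp (-s * interference X Y h P α D ω)) ∂μ ≤
      ∫⁻ ω in originOutsideHoles Y D,
        ((∏ n ∈ Finset.range N, fadingFactor P α D s (fun k => Y k ω) (X n ω) : ℝ≥0) :
          ℝ≥0∞) ∂μ := by
  let V : Ω → (ℕ → Plane) × (ℕ → Plane) := fun ω => (fun n => Y n ω, fun n => X n ω)
  let F : (ℕ → ℝ) × ((ℕ → Plane) × (ℕ → Plane)) → ℝ≥0∞ := fun p => ∏ n ∈ Finset.range N,
      ENNReal.ofReal (Real.exp (-(s * pathGain P α D p.2.1 (p.2.2 n) * p.1 n)))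
  have hF : Measurable F := by
    refine Finset.measurable_prod _ fun n _ => ?_
    have h0 : Measurable fun p : (ℕ → ℝ) × ((ℕ → Plane) × (ℕ → Plane)) => (p.2.1, p.2.2 n) := by
      fun_prop
    have h1 : Measurable fun p : (ℕ → ℝ) × ((ℕ → Plane) × (ℕ → Plane)) =>
        pathGain P α D p.2.1 (p.2.2 n) :=
      Measurable.comp (g := fun q : (ℕ → Plane) × Plane => pathGain P α D q.1 q.2)
        (f := fun p : (ℕ → ℝ) × ((ℕ → Plane) × (ℕ → Plane)) => (p.2.1, p.2.2 n))
        (measurable_pathGain P α D) h0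
    have h2 : Measurable fun p : (ℕ → ℝ) × ((ℕ → Plane) × (ℕ → Plane)) => p.1 n := by
      fun_prop
    exact (Real.measurable_exp.comp ((h1.const_mul s).mul h2).neg).ennreal_ofReal
  have hhm : Measurable fun ω n => h n ω := measurable_pi_lambda _ hh.measurable
  have hV : Measurable V := (measurable_pi_lambda _ hY).prodMk (measurable_pi_lambda _ hX)
  have hE : originOutsideHoles Y D = V ⁻¹' (Prod.fst ⁻¹' originFree D) := by
    rw [originOutsideHoles_eq]; rfl
  calc ∫⁻ ω in originOutsideHoles Y D,
        ENNReal.ofReal (Real.exp (-s * interference X Y h P α D ω)) ∂μ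
      ≤ ∫⁻ ω in originOutsideHoles Y D, F (fun n => h n ω, V ω) ∂μ := by
        refine lintegral_mono_ae (ae_restrict_of_ae ?_)
        filter_upwards [hsum, hh.ae_nonneg] with ω hω hpos
        simp only [F, V]
        rw [← ENNReal.ofReal_prod_of_nonneg fun _ _ => (Real.exp_pos _).le, ← Real.exp_sum,
          Finset.sum_neg_distrib]
        refine ENNReal.ofReal_le_ofReal (Real.exp_le_exp.2 ?_)
        rw [neg_mul, neg_le_neg_iff]
        simp_rw [mul_assoc, ← receivedPower_eq]
        rw [← Finset.mul_sum]
        refine mul_le_mul_of_nonneg_left (hω.sum_le_tsum _ fun n _ => ?_) hs.le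
        rw [receivedPower_eq]
        exact mul_nonneg (pathGain_nonneg hP.le _ _ _ _) (hpos n)
    _ = ∫⁻ ω in originOutsideHoles Y D, ∫⁻ ω', F (fun n => h n ω', V ω) ∂μ ∂μ := by
        rw [hE]
        exact setLIntegral_comp_indepFun hhm hV hhYX hF
          (measurable_fst (measurableSet_originFree D))
    _ = ∫⁻ ω in originOutsideHoles Y D,
        ((∏ n ∈ Finset.range N, fadingFactor P α D s (fun k => Y k ω) (X n ω) : ℝ≥0) :
          ℝ≥0∞) ∂μ := by
        refine lintegral_congr fun ω => ?_
        have h1 := hh.lintegral_prod_exp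
          (a := fun n => s * pathGain P α D (fun k => Y k ω) (X n ω))
          (fun n => mul_nonneg hs.le (pathGain_nonneg hP.le _ _ _ _)) N
        rw [ENNReal.ofNNReal_finsetProd]
        exact h1

/-- Averaging over the fading and over the baseline process, for given hole centres. -/
lemma setLIntegral_exp_interference_le [IsProbabilityMeasure μ] (hlam₂ : 0 < lam₂) (hP : 0 < P)
    (hα : 2 < α) (hs : 0 < s)
    (hY : ∀ n, Measurable (Y n)) (hX : IsPoissonPointProcess μ X lam₂) (hh : IsRayleighFading μ h)
    (hYX : IndepFun (fun ω n => Y n ω) (fun ω n => X n ω) μ)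
    (hhYX : IndepFun (fun ω n => h n ω) (fun ω => (fun n => Y n ω, fun n => X n ω)) μ)
    (hsum : ∀ᵐ ω ∂μ, Summable (receivedPower X Y h P α D ω)) :
    ∫⁻ ω in originOutsideHoles Y D,
        ENNReal.ofReal (Real.exp (-s * interference X Y h P α D ω)) ∂μ ≤
      ∫⁻ ω in originOutsideHoles Y D, ENNReal.ofReal (Real.exp
        (-(lam₂ * ∫ z, (1 - (fadingFactor P α D s (fun k => Y k ω) z : ℝ))))) ∂μ := by
  let F : ℕ → (ℕ → Plane) × (ℕ → Plane) → ℝ≥0∞ := fun N p =>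
    ((∏ n ∈ Finset.range N, fadingFactor P α D s p.2 (p.1 n) : ℝ≥0) : ℝ≥0∞)
  have hF : ∀ N, Measurable (F N) := by
    refine fun N => (Finset.measurable_prod _ fun n _ => ?_).coe_nnreal_ennreal
    have h0 : Measurable fun p : (ℕ → Plane) × (ℕ → Plane) => (p.2, p.1 n) := by fun_prop
    exact Measurable.comp (g := fun q : (ℕ → Plane) × Plane => fadingFactor P α D s q.1 q.2)
      (f := fun p : (ℕ → Plane) × (ℕ → Plane) => (p.2, p.1 n))
      (measurable_fadingFactor P α D s) h0
  have hXm : Measurable fun ω n => X n ω := measurable_pi_lambda _ hX.measurable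
  have hYm : Measurable fun ω n => Y n ω := measurable_pi_lambda _ hY
  have hE : originOutsideHoles Y D = (fun ω n => Y n ω) ⁻¹' originFree D := by
    rw [originOutsideHoles_eq]; rfl
  calc ∫⁻ ω in originOutsideHoles Y D,
        ENNReal.ofReal (Real.exp (-s * interference X Y h P α D ω)) ∂μ
      ≤ ⨅ N, ∫⁻ ω in originOutsideHoles Y D, F N (fun n => X n ω, fun n => Y n ω) ∂μ :=
        le_iInf fun N => setLIntegral_exp_interference_le_prod hP hs hY hX.measurable hh hhYX hsum N
    _ = ∫⁻ ω in originOutsideHoles Y D, ⨅ N, F N (fun n => X n ω, fun n => Y n ω) ∂μ := by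
        symm
        refine lintegral_iInf (f := fun N ω => F N (fun n => X n ω, fun n => Y n ω))
          (fun N => (hF N).comp (hXm.prodMk hYm)) ?_ (by simp [F])
        intro M N hMN ω
        exact ENNReal.coe_le_coe.2 (Finset.prod_le_prod_of_subset_of_le_one'
          (Finset.range_mono hMN) fun n _ _ => fadingFactor_le_one hP hs _ _)
    _ = ∫⁻ ω in originOutsideHoles Y D,
          ∫⁻ ω', ⨅ N, F N (fun n => X n ω', fun n => Y n ω) ∂μ ∂μ := by
        rw [hE]
        exact setLIntegral_comp_indepFun (F := fun p => ⨅ N, F N p) hXm hYm hYX.symm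
          (Measurable.iInf hF) (measurableSet_originFree D)
    _ ≤ _ := by
        refine lintegral_mono fun ω => ?_
        exact hX.lintegral_iInf_prod_le hlam₂.le (measurable_fadingFactor_right P α D s _)
          (fadingFactor_le_one hP hs _) (integrable_one_sub_fadingFactor hP hs hα _)

end Laplace

/-! ### Averaging over the hole centres -/

/-- The mass of a disk is a convolution, hence an integrable function of the centre. -/
lemma integrable_setIntegral_ball {F : Plane → ℝ} (hF : Integrable F) (D : ℝ) :
    Integrable fun y => ∫ x in Metric.ball y D, F x := by
  have h1 : Integrable ((Metric.ball (0 : Plane) D).indicator fun _ => (1 : ℝ)) :=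
    (integrable_indicator_iff measurableSet_ball).2 (integrableOn_const measure_ball_lt_top.ne)
  have h2 := hF.integrable_convolution (ContinuousLinearMap.mul ℝ ℝ) h1
  refine h2.congr (Eventually.of_forall fun y => ?_)
  simp only [convolution, ContinuousLinearMap.mul_apply']
  rw [← integral_indicator measurableSet_ball]
  refine integral_congr_ae (Eventually.of_forall fun x => ?_)
  have h3 : y - x ∈ Metric.ball (0 : Plane) D ↔ x ∈ Metric.ball y D := by
    rw [mem_ball_zero_iff, Metric.mem_ball, dist_comm, dist_eq_norm]
  simp only
  by_cases hx : x ∈ Metric.ball y D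
  · rw [Set.indicator_of_mem hx, Set.indicator_of_mem (h3.2 hx), mul_one]
  · rw [Set.indicator_of_notMem hx, Set.indicator_of_notMem fun h => hx (h3.1 h), mul_zero]

lemma integrable_exp_sub_one {E : Type*} [MeasurableSpace E] {ν : Measure E} {f : E → ℝ}
    (hf : Integrable f ν) (hf0 : ∀ x, 0 ≤ f x) {M : ℝ} (hM : ∀ x, f x ≤ M) :
    Integrable (fun x => Real.exp (f x) - 1) ν := by
  refine (hf.mul_const (Real.exp M)).mono'
    ((Real.measurable_exp.comp_aemeasurable hf.1.aemeasurable).sub_const 1).aestronglyMeasurable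
    (Eventually.of_forall fun x => ?_)
  have h0 := hf0 x
  have h1 : 0 ≤ Real.exp (f x) - 1 := sub_nonneg.2 (Real.one_le_exp h0)
  rw [Real.norm_of_nonneg h1]
  -- multiply `1 - t ≤ exp (-t)` by `exp t`
  have h2 := Real.add_one_le_exp (-f x)
  have h3 : Real.exp (-f x) * Real.exp (f x) = 1 := by rw [← Real.exp_add]; simp
  have h4 : Real.exp (f x) ≤ Real.exp M := Real.exp_le_exp.2 (hM x)
  nlinarith [Real.exp_pos (f x)]

section HoleCentres

variable {lam₂ P α D s : ℝ}

lemma holeExponent_indicator_ae (lam₂ α : ℝ) (hP : 0 < P) (hs : 0 < s) (hD : 0 < D) :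
    (fun y : Plane => (Set.Ioi D).indicator
      (fun v => Real.exp (holeExponent lam₂ P α D s v) - 1) ‖y‖) =ᵐ[volume]
    (Metric.ball (0 : Plane) D)ᶜ.indicator fun y =>
      Real.exp (lam₂ * ∫ x in Metric.ball y D, lossDensity (P * s) α ‖x‖) - 1 := by
  have h0 : ∀ᵐ y : Plane, y ∉ Metric.sphere (0 : Plane) D := by
    exact measure_eq_zero_iff_ae_notMem.1 (Measure.addHaar_sphere volume (0 : Plane) D)
  filter_upwards [h0] with y hy
  rw [mem_sphere_zero_iff_norm] at hy
  by_cases h : D < ‖y‖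
  · rw [Set.indicator_of_mem (Set.mem_Ioi.2 h), Set.indicator_of_mem, holeExponent_norm hP hs hD h]
    simpa using h.le
  · rw [Set.indicator_of_notMem (by simpa using h), Set.indicator_of_notMem]
    simpa using lt_of_le_of_ne (not_lt.1 h) hy

lemma integrable_exp_holeMass (hlam₂ : 0 < lam₂) (hP : 0 < P) (hα : 2 < α) (hs : 0 < s) (D : ℝ) :
    Integrable fun y : Plane =>
      Real.exp (lam₂ * ∫ x in Metric.ball y D, lossDensity (P * s) α ‖x‖) - 1 := by
  have hL := integrable_lossDensity_norm (mul_pos hP hs) hα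
  have h0 : ∀ x : Plane, 0 ≤ lossDensity (P * s) α ‖x‖ := fun x =>
    (lossDensity_pos (mul_pos hP hs) (norm_nonneg x)).le
  refine integrable_exp_sub_one (M := lam₂ * ∫ x : Plane, lossDensity (P * s) α ‖x‖)
    ((integrable_setIntegral_ball hL D).const_mul lam₂)
    (fun y => mul_nonneg hlam₂.le (integral_nonneg h0)) fun y => ?_
  exact mul_le_mul_of_nonneg_left (setIntegral_le_integral hL (ae_of_all _ h0)) hlam₂.le

lemma integrable_holeExponent_norm (hlam₂ : 0 < lam₂) (hP : 0 < P) (hα : 2 < α) (hs : 0 < s)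
    (hD : 0 < D) :
    Integrable fun y : Plane => (Set.Ioi D).indicator
      (fun v => Real.exp (holeExponent lam₂ P α D s v) - 1) ‖y‖ :=
  ((integrable_exp_holeMass hlam₂ hP hα hs D).indicator measurableSet_ball.compl).congr
    (holeExponent_indicator_ae lam₂ α hP hs hD).symm

lemma integrableOn_holeExponent (hlam₂ : 0 < lam₂) (hP : 0 < P) (hα : 2 < α) (hs : 0 < s)
    (hD : 0 < D) :
    IntegrableOn (fun v => (1 - Real.exp (holeExponent lam₂ P α D s v)) * v) (Set.Ioi D) := by
  have h1 := (integrable_fun_norm_addHaar (volume : Measure Plane)).1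
    (integrable_holeExponent_norm hlam₂ hP hα hs hD)
  refine ((h1.mono_set (Set.Ioi_subset_Ioi hD.le)).neg).congr_fun (fun v hv => ?_) measurableSet_Ioi
  simp only [Pi.neg_apply, finrank_euclideanSpace, Fintype.card_fin, smul_eq_mul]
  rw [Set.indicator_of_mem hv]
  ring

lemma integral_exp_holeMass (hP : 0 < P) (hs : 0 < s) (hD : 0 < D) :
    ∫ y in (Metric.ball (0 : Plane) D)ᶜ,
      (Real.exp (lam₂ * ∫ x in Metric.ball y D, lossDensity (P * s) α ‖x‖) - 1) =
    -(2 * Real.pi * ∫ v in Set.Ioi D, (1 - Real.exp (holeExponent lam₂ P α D s v)) * v) := by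
  rw [← integral_indicator measurableSet_ball.compl,
    ← integral_congr_ae (holeExponent_indicator_ae lam₂ α hP hs hD),
    integral_fun_norm_addHaar (volume : Measure Plane)]
  have h1 : volume.real (Metric.ball (0 : Plane) 1) = Real.pi := by
    simp [Measure.real, EuclideanSpace.volume_ball_fin_two, Real.pi_pos.le]
  have h2 : ∀ v ∈ Set.Ioi (0 : ℝ), v ^ (2 - 1) * (Set.Ioi D).indicator
      (fun v => Real.exp (holeExponent lam₂ P α D s v) - 1) v =
      (Set.Ioi D).indicator
        (fun v => -((1 - Real.exp (holeExponent lam₂ P α D s v)) * v)) v := by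
    intro v _
    by_cases hv : v ∈ Set.Ioi D
    · rw [Set.indicator_of_mem hv, Set.indicator_of_mem hv]; ring
    · rw [Set.indicator_of_notMem hv, Set.indicator_of_notMem hv, mul_zero]
  rw [h1]
  simp only [finrank_euclideanSpace, Fintype.card_fin, smul_eq_mul, nsmul_eq_mul]
  rw [setIntegral_congr_fun measurableSet_Ioi h2, setIntegral_indicator measurableSet_Ioi,
    Set.inter_eq_right.2 (Set.Ioi_subset_Ioi hD.le), integral_neg]
  push_cast
  ring

/-- Averaging over the hole centres on the event that the origin lies outside the holes. -/
lemma setLIntegral_iSup_prod_exp_holeMass_le {Ω : Type*} [MeasurableSpace Ω] {μ : Measure Ω}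
    [IsProbabilityMeasure μ] {Y : ℕ → Ω → Plane} {lam₁ : ℝ} (hlam₁ : 0 < lam₁)
    (hlam₂ : 0 < lam₂) (hP : 0 < P) (hα : 2 < α) (hs : 0 < s) (hD : 0 < D)
    (hY : IsPoissonPointProcess μ Y lam₁) :
    ∫⁻ ω in originOutsideHoles Y D, ⨆ N, ∏ n ∈ Finset.range N, ENNReal.ofReal
        (Real.exp (lam₂ * ∫ x in Metric.ball (Y n ω) D, lossDensity (P * s) α ‖x‖)) ∂μ ≤
      ENNReal.ofReal (Real.exp (-(lam₁ * (Real.pi * D ^ 2))) * Real.exp (-2 * Real.pi * lam₁ *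
        ∫ v in Set.Ioi D, (1 - Real.exp (holeExponent lam₂ P α D s v)) * v)) := by
  let m : Plane → ℝ := fun y => lam₂ * ∫ x in Metric.ball y D, lossDensity (P * s) α ‖x‖
  have hL := integrable_lossDensity_norm (mul_pos hP hs) hα
  have hm0 : ∀ y, 0 ≤ m y := fun y => mul_nonneg hlam₂.le
    (integral_nonneg fun x => (lossDensity_pos (mul_pos hP hs) (norm_nonneg x)).le)
  have hmm : Measurable m := by
    have h1 : MeasurableSet {p : Plane × Plane | p.2 ∈ Metric.ball p.1 D} :=
      measurableSet_lt (measurable_snd.dist measurable_fst) measurable_const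
    have h2 : StronglyMeasurable fun p : Plane × Plane =>
        (Metric.ball p.1 D).indicator (fun x => lossDensity (P * s) α ‖x‖) p.2 := by
      have h3 : Measurable fun p : Plane × Plane => lossDensity (P * s) α ‖p.2‖ :=
        (measurable_lossDensity _ α).comp measurable_snd.norm
      exact (h3.indicator h1).stronglyMeasurable
    have h4 := StronglyMeasurable.integral_prod_right (f := fun y x : Plane =>
      (Metric.ball y D).indicator (fun x => lossDensity (P * s) α ‖x‖) x) h2
      (ν := (volume : Measure Plane))
    simp only [integral_indicator measurableSet_ball] at h4
    exact h4.measurable.const_mul lam₂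
  -- on the event no hole centre lies in the disk, so the value `0` there is never seen
  let v : Plane → ℝ≥0 := (Metric.ball (0 : Plane) D)ᶜ.indicator fun y =>
    Real.toNNReal (Real.exp (m y))
  have hv0 : ∀ y ∈ Metric.ball (0 : Plane) D, v y = 0 := fun y hy =>
    Set.indicator_of_notMem (Set.notMem_compl_iff.2 hy) _
  have hv : ∀ y ∉ Metric.ball (0 : Plane) D, v y = Real.toNNReal (Real.exp (m y)) := fun y hy =>
    Set.indicator_of_mem (show y ∈ (Metric.ball (0 : Plane) D)ᶜ from hy) _
  have hvm : Measurable v :=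
    (Real.measurable_exp.comp hmm).real_toNNReal.indicator measurableSet_ball.compl
  have hv1 : ∀ y ∉ Metric.ball (0 : Plane) D, 1 ≤ v y := by
    intro y hy
    rw [hv y hy, Real.one_le_toNNReal]
    exact Real.one_le_exp (hm0 y)
  -- the value `-1` on the disk around the origin yields the factor `exp (-lam₁ * π * D ^ 2)`,
  -- the probability of the event
  have hsub : (fun y => (v y : ℝ) - 1) =
      (fun y => (Metric.ball (0 : Plane) D)ᶜ.indicator (fun y => Real.exp (m y) - 1) y -
        (Metric.ball (0 : Plane) D).indicator (fun _ => 1) y) := by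
    ext y
    by_cases hy : y ∈ Metric.ball (0 : Plane) D
    · rw [hv0 y hy, Set.indicator_of_mem hy, Set.indicator_of_notMem (Set.notMem_compl_iff.2 hy)]
      simp
    · rw [hv y hy, Set.indicator_of_notMem hy,
        Set.indicator_of_mem (show y ∈ (Metric.ball (0 : Plane) D)ᶜ from hy),
        Real.coe_toNNReal _ (Real.exp_pos _).le, sub_zero]
  have hi1 : Integrable ((Metric.ball (0 : Plane) D)ᶜ.indicator fun y => Real.exp (m y) - 1) :=
    (integrable_exp_holeMass hlam₂ hP hα hs D).indicator measurableSet_ball.compl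
  have hi2 : Integrable ((Metric.ball (0 : Plane) D).indicator fun _ => (1 : ℝ)) :=
    (integrable_indicator_iff measurableSet_ball).2 (integrableOn_const measure_ball_lt_top.ne)
  have hvol : volume.real (Metric.ball (0 : Plane) D) = Real.pi * D ^ 2 := by
    rw [Measure.real, EuclideanSpace.volume_ball_fin_two, ENNReal.toReal_mul, ENNReal.toReal_pow,
      ENNReal.toReal_ofReal hD.le, mul_comm]
    simp [Real.pi_pos.le]
  have hint : ∫ y, ((v y : ℝ) - 1) =
      -(2 * Real.pi * ∫ v in Set.Ioi D, (1 - Real.exp (holeExponent lam₂ P α D s v)) * v) -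
        Real.pi * D ^ 2 := by
    rw [hsub, integral_sub hi1 hi2, integral_indicator measurableSet_ball.compl,
      integral_exp_holeMass hP hs hD, integral_indicator_const _ measurableSet_ball, hvol]
    simp
  have hE := originOutsideHoles_eq Y D
  have key := hY.setLIntegral_iSup_prod_le hlam₁.le measurableSet_ball Metric.isBounded_ball hvm
    hv0 hv1 (by rw [hsub]; exact hi1.sub hi2)
  rw [← hE, hint] at key
  refine le_trans (le_of_eq ?_) (key.trans (le_of_eq ?_))
  · refine setLIntegral_congr_fun (measurableSet_originOutsideHoles hY.measurable) fun ω hω => ?_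
    rw [hE] at hω
    refine iSup_congr fun N => ?_
    rw [ENNReal.ofNNReal_finsetProd]
    refine Finset.prod_congr rfl fun n _ => ?_
    rw [hv _ (hω n)]
    rfl
  · rw [← Real.exp_add]
    congr 2
    ring

end HoleCentres

/-! ### The Laplace transform bound -/

theorem theorem2 {Ω : Type*} [MeasurableSpace Ω] (μ : Measure Ω) [IsProbabilityMeasure μ]
    (lam₁ lam₂ P α D s : ℝ) (hlam₁ : 0 < lam₁) (hlam₂ : 0 < lam₂) (hP : 0 < P) (hα : 2 < α)
    (hD : 0 < D) (hs : 0 < s)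
    -- the hole centres `Y`, the baseline process `X` and the fading gains `h`
    (Y X : ℕ → Ω → Plane) (h : ℕ → Ω → ℝ)
    (hY : IsPoissonPointProcess μ Y lam₁) (hX : IsPoissonPointProcess μ X lam₂)
    (hh : IsRayleighFading μ h)
    (hYX : IndepFun (fun ω n => Y n ω) (fun ω n => X n ω) μ)
    (hhYX : IndepFun (fun ω n => h n ω) (fun ω => (fun n => Y n ω, fun n => X n ω)) μ) :
    -- the interference series converges almost surely
    (∀ᵐ ω ∂(μ[|originOutsideHoles Y D]), Summable (receivedPower X Y h P α D ω)) ∧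
    -- its Laplace transform is well defined
    Integrable (fun ω => Real.exp (-s * interference X Y h P α D ω))
      (μ[|originOutsideHoles Y D]) ∧
    -- the integral in the bound converges
    IntegrableOn (fun v => (1 - Real.exp (holeExponent lam₂ P α D s v)) * v) (Set.Ioi D) ∧
    -- the bound
    ∫ ω, Real.exp (-s * interference X Y h P α D ω) ∂(μ[|originOutsideHoles Y D]) ≤
      Real.exp (-Real.pi * lam₂ * ((s * P) ^ (2 / α) / normalizedSinc (2 / α))) *
        Real.exp (-2 * Real.pi * lam₁ *
          ∫ v in Set.Ioi D, (1 - Real.exp (holeExponent lam₂ P α D s v)) * v) := by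
  have hsum : ∀ᵐ ω ∂μ, Summable (receivedPower X Y h P α D ω) :=
    ae_summable_receivedPower hP hα hX hh (hhYX.comp measurable_id measurable_snd)
  have hac : μ[|originOutsideHoles Y D] ≪ μ := cond_absolutelyContinuous
  have hμE := measure_originOutsideHoles hlam₁ hD hY
  have hcond : IsProbabilityMeasure (μ[|originOutsideHoles Y D]) :=
    cond_isProbabilityMeasure (by rw [hμE]; simp [Real.exp_pos])
  have hmeas : AEMeasurable (fun ω => Real.exp (-s * interference X Y h P α D ω)) μ :=
    Real.measurable_exp.comp_aemeasurable
      ((aemeasurable_interference hY.measurable hX.measurable hh.measurable hsum).const_mul (-s))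
  have hI0 : ∀ᵐ ω ∂μ, 0 ≤ interference X Y h P α D ω := by
    filter_upwards [hh.ae_nonneg] with ω hω
    refine tsum_nonneg fun n => ?_
    rw [receivedPower_eq]
    exact mul_nonneg (pathGain_nonneg hP.le _ _ _ _) (hω n)
  refine ⟨hac.ae_le hsum, ?_, integrableOn_holeExponent hlam₂ hP hα hs hD, ?_⟩
  · refine (integrable_const (1 : ℝ)).mono' (hmeas.mono_ac hac).aestronglyMeasurable ?_
    filter_upwards [hac.ae_le hI0] with ω hω
    rw [Real.norm_of_nonneg (Real.exp_pos _).le, Real.exp_le_one_iff]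
    nlinarith
  set J := ∫ x : Plane, lossDensity (P * s) α ‖x‖ with hJ
  have hL := integrable_lossDensity_norm (mul_pos hP hs) hα
  have hL0 : ∀ x : Plane, 0 ≤ lossDensity (P * s) α ‖x‖ := fun x =>
    (lossDensity_pos (mul_pos hP hs) (norm_nonneg x)).le
  set K := Real.exp (-2 * Real.pi * lam₁ *
          ∫ v in Set.Ioi D, (1 - Real.exp (holeExponent lam₂ P α D s v)) * v) with hK
  -- `q` is the probability of the event, which the normalization of the conditional measure cancels
  set q := Real.exp (-(lam₁ * (Real.pi * D ^ 2))) with hq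
  have hq0 : 0 < q := Real.exp_pos _
  have hbound : ∫⁻ ω in originOutsideHoles Y D,
      ENNReal.ofReal (Real.exp (-s * interference X Y h P α D ω)) ∂μ ≤
      ENNReal.ofReal (Real.exp (-(lam₂ * J)) * (q * K)) := by
    refine (setLIntegral_exp_interference_le hlam₂ hP hα hs hY.measurable hX hh hYX
      hhYX hsum).trans ?_
    rw [ENNReal.ofReal_mul (Real.exp_pos _).le]
    refine le_trans ?_ (mul_le_mul_right
      (setLIntegral_iSup_prod_exp_holeMass_le hlam₁ hlam₂ hP hα hs hD hY) _)
    rw [← lintegral_const_mul' _ _ ENNReal.ofReal_ne_top]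
    refine lintegral_mono fun ω => ?_
    rw [integral_one_sub_fadingFactor hP hs hα, ← hJ, mul_sub, neg_sub, sub_eq_neg_add,
      Real.exp_add, ENNReal.ofReal_mul (Real.exp_pos _).le]
    exact mul_le_mul_right (ofReal_exp_setIntegral_iUnion_ball_le hL hL0 hlam₂.le _ D) _
  have hJ' : Real.exp (-Real.pi * lam₂ * ((s * P) ^ (2 / α) / normalizedSinc (2 / α))) =
      Real.exp (-(lam₂ * J)) := by
    rw [hJ, integral_lossDensity_norm (mul_pos hP hs) hα, mul_comm s P]
    congr 1; ring
  rw [hJ', integral_eq_lintegral_of_nonneg_ae (Eventually.of_forall fun _ => (Real.exp_pos _).le)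
    (hmeas.mono_ac hac).aestronglyMeasurable]
  refine ENNReal.toReal_le_of_le_ofReal (by positivity) ?_
  rw [ProbabilityTheory.cond, lintegral_smul_measure, hμE, smul_eq_mul]
  refine (mul_le_mul_right hbound _).trans (le_of_eq ?_)
  rw [← ENNReal.ofReal_inv_of_pos hq0, ← ENNReal.ofReal_mul (by positivity)]
  congr 1
  field_simp
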